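/- **Setting.** Let $1\le N\le 3$, let $\Omega\subset\mathbb R^N$ be open and bounded, $0<T<\infty$, and let $\langle\cdot,\cdot\rangle$ be the inner product of $L^2(\Omega)$ or $L^2(\Omega)^N$. The data are reals $S_m>0$, $\alpha_L>\alpha_T\ge 0$, $R>0$, a measurable porosity $\psi$ with $0<\psi_-\le\psi\le\psi_+$ a.e. in $\Omega$, $p\in L^2(\Omega)$, a function $r:\mathbb R\to\mathbb R$, a boundary condition $\chi\in\{0,1\}$ ($0$: Dirichlet, $1$: Neumann), and $c_0\in H^1(\Omega)$, with $c_0\in H^1_0(\Omega)$ if $\chi=0$. The dispersion tensor is $$S(v)=S_m\,\mathrm{Id}+|v|\Bigl(\tfrac{\alpha_L}{|v|^2}\,v\otimes v+\alpha_T\bigl(\mathrm{Id}-\tfrac1{|v|^2}\,v\otimes v\bigr)\Bigr),\qquad S(0)=S_m\,\mathrm{Id},$$ $S(v)^{1/2}$ is its symmetric positive definite square root, and $S(v)^{-1/2}=(S(v)^{1/2})^{-1}$. Let $\mathcal T_h$ be a conforming decomposition of $\overline\Omega$ into finitely many closed nondegenerate $N$-simplices. Let $W_h$ be the space of functions in $L^2(\Omega)$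 that are constant on each element, $U_h$ the space of fields in $H(\mathrm{div},\Omega)$ whose components are polynomials of degree at most $1$ on each element, and $U_{h,0}=\{u\in U_h: u\cdot n=0\text{ on }\partial\Omega\}$ (the normal trace being understood as a functional on $H^1(\Omega)$). Put $U_h^\chi=U_h$ if $\chi=0$ and $U_h^\chi=U_{h,0}$ if $\chi=1$. For a time step $\tau>0$ let $M=\lfloor T/\tau\rfloor$, and let $v_h\in U_h$. A *solution of the fully discrete scheme* is a family $(c_h^n,v_{c,h}^n)_{0\le n\le M}$ with $c_h^n\in W_h$, $v_{c,h}^n\in L^2(\Omega)^N$, $S(v_h)^{1/2}v_{c,h}^n\in U_h^\chi$, such that $c_h^0$ is the $L^2(\Omega)$-projection of $c_0$ on $W_h$, $$\langle R\psi(c_h^n-c_h^{n-1}),w_h\rangle+\tau\langle \mathrm{div}(S(v_h)^{1/2}v_{c,h}^n),w_h\rangle+\tau\langle r(c_h^{n-1}),w_h\rangle-\tau\langle p,w_h\rangle=0\qquad\forall w_h\in W_h,\ 1\le n\le M,$$ $$\langle S(v_h)^{-1/2}\psi^{-1}v_{c,h}^n,u_h\rangle-\langle c_h^n,\mathrm{div}\,u_h\rangle-\langle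 S(v_h)^{-1}\psi^{-1}v_hc_h^n,u_h\rangle=0\qquad\forall u_h\in U_h^\chi,\ 0\le n\le M.$$ **Theorem.** Assume that $r$ is bounded on $\mathbb R$, or that there is $r^+\in\mathbb R$ with $|r(x)|\le r^+|x|$ for all $x\in\mathbb R$. Let $K\in\mathbb R$. There is a constant $C$, depending only on $\Omega$, $T$, $K$ and the data ($S_m,\alpha_L,\alpha_T,R,\psi,r,p,c_0,\chi$), and not on $\mathcal T_h$, $\tau$ and $v_h$, such that every solution of the fully discrete scheme that satisfies $$\|c_h^n\|_{L^2(\Omega)}^2+\tau\|v_{c,h}^n\|_{L^2(\Omega)}^2\le K\qquad(1\le n\le M)$$ satisfies $$\frac1\tau\sum_{n=1}^{M}\|c_h^n-c_h^{n-1}\|_{L^2(\Omega)}^2+\sup_{0\le k\le M}\|v_{c,h}^k\|_{L^2(\Omega)}^2+\sum_{n=1}^{M}\|v_{c,h}^n-v_{c,h}^{n-1}\|_{L^2(\Omega)}^2\le C\bigl(1+\|v_h\|_{L^\infty(\Omega)}+\|v_h\|_{L^\infty(\Omega)}^2\bigr)$$ and $$\tau\sum_{n=1}^{M}\|\mathrm{div}(S(v_h)^{1/2}v_{c,h}^n)\|_{L^2(\Omega)}^2\le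 C\bigl(1+\|v_h\|_{L^\infty(\Omega)}+\|v_h\|_{L^\infty(\Omega)}^2\bigr).$$ -/

import Mathlib

open MeasureTheory
open scoped ContDiff

noncomputable section

/-- The Euclidean space `ℝ^N`. -/
abbrev Eu (N : ℕ) := EuclideanSpace ℝ (Fin N)

/-! ### Norms, inner products and first order Sobolev notions on `Ω` -/

/-- The norm of `L²(Ω)`, for scalar or vector fields. -/
def l2norm {N : ℕ} {F : Type*} [NormedAddCommGroup F] (Ω : Set (Eu N)) (f : Eu N → F) : ℝ :=
  (eLpNorm f 2 (volume.restrict Ω)).toReal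

/-- The norm of `L^∞(Ω)`, for scalar or vector fields (Euclidean norm of the values). -/
def linfnorm {N : ℕ} {F : Type*} [NormedAddCommGroup F] (Ω : Set (Eu N)) (f : Eu N → F) : ℝ :=
  (eLpNorm f ⊤ (volume.restrict Ω)).toReal

/-- The inner product `⟨f, g⟩ = ∫_Ω f · g`, for scalar or vector fields. -/
def ip {N : ℕ} {F : Type*} [NormedAddCommGroup F] [InnerProductSpace ℝ F] (Ω : Set (Eu N))
    (f g : Eu N → F) : ℝ :=
  ∫ x in Ω, inner ℝ (f x) (g x)

/-- `f ∈ L²(Ω)`. -/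
def InL2 {N : ℕ} {F : Type*} [NormedAddCommGroup F] (Ω : Set (Eu N)) (f : Eu N → F) : Prop :=
  MemLp f 2 (volume.restrict Ω)

/-- `φ ∈ C_c^∞(Ω)`. -/
def IsTestFunction {N : ℕ} (Ω : Set (Eu N)) (φ : Eu N → ℝ) : Prop :=
  ContDiff ℝ ∞ φ ∧ HasCompactSupport φ ∧ tsupport φ ⊆ Ω

/-- `f ∈ H¹(Ω)` with weak gradient `G`. -/
def HasWeakGrad {N : ℕ} (Ω : Set (Eu N)) (f : Eu N → ℝ) (G : Eu N → Eu N) : Prop :=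
  InL2 Ω f ∧ InL2 Ω G ∧
    ∀ φ : Eu N → ℝ, IsTestFunction Ω φ →
      ∫ x in Ω, f x • gradient φ x = - ∫ x in Ω, φ x • G x

/-- `f ∈ H¹(Ω)`. -/
def InH1 {N : ℕ} (Ω : Set (Eu N)) (f : Eu N → ℝ) : Prop :=
  ∃ G : Eu N → Eu N, HasWeakGrad Ω f G

/-- `f ∈ H¹₀(Ω)`, the closure of `C_c^∞(Ω)` in `H¹(Ω)`. -/
def InH10 {N : ℕ} (Ω : Set (Eu N)) (f : Eu N → ℝ) : Prop :=
  ∃ G : Eu N → Eu N, HasWeakGrad Ω f G ∧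
    ∀ ε : ℝ, 0 < ε → ∃ φ : Eu N → ℝ, IsTestFunction Ω φ ∧
      l2norm Ω (fun x => f x - φ x) < ε ∧ l2norm Ω (fun x => G x - gradient φ x) < ε

/-- `q ∈ H(div, Ω)` with weak divergence `d ∈ L²(Ω)`. -/
def HasWeakDiv {N : ℕ} (Ω : Set (Eu N)) (q : Eu N → Eu N) (d : Eu N → ℝ) : Prop :=
  InL2 Ω q ∧ InL2 Ω d ∧
    ∀ φ : Eu N → ℝ, IsTestFunction Ω φ →
      ∫ x in Ω, inner ℝ (q x) (gradient φ x) = - ∫ x in Ω, d x * φ x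

/-- `q ∈ H(div, Ω)`. -/
def InHdiv {N : ℕ} (Ω : Set (Eu N)) (q : Eu N → Eu N) : Prop :=
  ∃ d : Eu N → ℝ, HasWeakDiv Ω q d

open Classical in
/-- The weak divergence of a field in `H(div, Ω)` (well defined up to a null set). -/
def divg {N : ℕ} (Ω : Set (Eu N)) (q : Eu N → Eu N) : Eu N → ℝ :=
  if h : InHdiv Ω q then h.choose else 0

theorem hasWeakDiv_divg {N : ℕ} {Ω : Set (Eu N)} {q : Eu N → Eu N} (h : InHdiv Ω q) :
    HasWeakDiv Ω q (divg Ω q) := by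
  unfold divg
  rw [dif_pos h]
  exact h.choose_spec

/-- `q ∈ H(div, Ω)` with `q · n = 0` on `∂Ω`: the normal trace, as a functional on `H¹(Ω)`,
vanishes. -/
def HasZeroNormalTrace {N : ℕ} (Ω : Set (Eu N)) (q : Eu N → Eu N) : Prop :=
  InHdiv Ω q ∧ ∀ (φ : Eu N → ℝ) (G : Eu N → Eu N), HasWeakGrad Ω φ G →
    (∫ x in Ω, inner ℝ (q x) (G x)) + ∫ x in Ω, divg Ω q x * φ x = 0

/-! ### The dispersion tensor -/

/-- The dispersion tensor
`S(v) = S_m Id + |v| (α_L |v|⁻² v ⊗ v + α_T (Id - |v|⁻² v ⊗ v))`, with `S(0) = S_m Id`. -/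
def dispersion {N : ℕ} (Sm αL αT : ℝ) (v : Eu N) : Matrix (Fin N) (Fin N) ℝ :=
  Sm • (1 : Matrix (Fin N) (Fin N) ℝ) +
    ‖v‖ • ((αL / ‖v‖ ^ 2) • Matrix.vecMulVec v.ofLp v.ofLp +
      αT • ((1 : Matrix (Fin N) (Fin N) ℝ) -
        (1 / ‖v‖ ^ 2) • Matrix.vecMulVec v.ofLp v.ofLp))

/-- `X` is a symmetric positive definite square root of `A`. -/
def IsPosSqrt {N : ℕ} (A X : Matrix (Fin N) (Fin N) ℝ) : Prop :=
  X.PosDef ∧ X * X = A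

open Classical in
/-- The symmetric positive definite square root of a matrix that has one. -/
def posSqrt {N : ℕ} (A : Matrix (Fin N) (Fin N) ℝ) : Matrix (Fin N) (Fin N) ℝ :=
  if h : ∃ X, IsPosSqrt A X then h.choose else 0

theorem isPosSqrt_posSqrt_dispersion {N : ℕ} {Sm αL αT : ℝ} (hSm : 0 < Sm) (hαT : 0 ≤ αT)
    (hα : αT < αL) (v : Eu N) :
    IsPosSqrt (dispersion Sm αL αT v) (posSqrt (dispersion Sm αL αT v)) := by
  have hex : ∃ X, IsPosSqrt (dispersion Sm αL αT v) X := by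
    set P : Matrix (Fin N) (Fin N) ℝ := (1 / ‖v‖ ^ 2) • Matrix.vecMulVec v.ofLp v.ofLp with hP
    have hdot : v.ofLp ⬝ᵥ v.ofLp = ‖v‖ ^ 2 := by
      rw [EuclideanSpace.norm_sq_eq]
      simp [dotProduct, sq]
    have hPP : P * P = P := by
      rw [hP, Matrix.smul_mul, Matrix.mul_smul, Matrix.vecMulVec_mul_vecMulVec, hdot]
      by_cases hv : ‖v‖ = 0
      · simp [hv]
      · rw [Matrix.vecMulVec_smul, smul_smul, smul_smul]
        congr 1
        field_simp
    have hPs : P.PosSemidef := by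
      have h := Matrix.posSemidef_vecMulVec_self_star v.ofLp
      simp only [star_trivial] at h
      exact h.smul (by positivity)
    have ha : 0 < Sm + αT * ‖v‖ := by positivity
    have hb : Sm + αT * ‖v‖ ≤ Sm + αL * ‖v‖ := by
      have := mul_le_mul_of_nonneg_right hα.le (norm_nonneg v)
      linarith
    set a := Real.sqrt (Sm + αT * ‖v‖) with hadef
    set b := Real.sqrt (Sm + αL * ‖v‖) with hbdef
    have haa : a * a = Sm + αT * ‖v‖ := Real.mul_self_sqrt ha.le
    have hbb : b * b = Sm + αL * ‖v‖ := Real.mul_self_sqrt (ha.le.trans hb)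
    have hab : a ≤ b := Real.sqrt_le_sqrt hb
    refine ⟨a • (1 : Matrix (Fin N) (Fin N) ℝ) + (b - a) • P, ?_, ?_⟩
    · exact (Matrix.PosDef.one.smul (Real.sqrt_pos.2 ha)).add_posSemidef
        (hPs.smul (sub_nonneg.2 hab))
    · have hS : dispersion Sm αL αT v
          = (Sm + αT * ‖v‖) • (1 : Matrix (Fin N) (Fin N) ℝ) + ((αL - αT) * ‖v‖) • P := by
        unfold dispersion
        rw [hP]
        module
      rw [hS]
      simp only [add_mul, mul_add, Matrix.smul_mul, Matrix.mul_smul, one_mul, mul_one, hPP]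
      have h2 : (αL - αT) * ‖v‖ = b * b - a * a := by rw [haa, hbb]; ring
      rw [h2, ← haa]
      module
  unfold posSqrt
  rw [dif_pos hex]
  exact hex.choose_spec

/-- The action of the matrix field `A` on the vector field `q`: `x ↦ A(x) q(x)`. -/
def matAct {N : ℕ} (A : Eu N → Matrix (Fin N) (Fin N) ℝ) (q : Eu N → Eu N) : Eu N → Eu N :=
  fun x => Matrix.toEuclideanLin (A x) (q x)

/-! ### Meshes and finite element spaces -/

/-- A conforming decomposition of `Ω` into finitely many closed (nondegenerate) `N`-simplices, each
given by its set of vertices. -/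
structure Mesh (N : ℕ) (Ω : Set (Eu N)) where
  elements : Finset (Finset (Eu N))
  card_vertices : ∀ s ∈ elements, s.card = N + 1
  nondegenerate : ∀ s ∈ elements, AffineIndependent ℝ (fun x : s => (x : Eu N))
  conforming : ∀ s ∈ elements, ∀ t ∈ elements,
    convexHull ℝ (s : Set (Eu N)) ∩ convexHull ℝ (t : Set (Eu N)) =
      convexHull ℝ ((s : Set (Eu N)) ∩ (t : Set (Eu N)))
  cover : ⋃ s ∈ elements, convexHull ℝ (s : Set (Eu N)) = closure Ω

/-- `W_h`: the functions of `L²(Ω)` that are constant on each element. -/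
def Wh {N : ℕ} {Ω : Set (Eu N)} (𝒯 : Mesh N Ω) : Set (Eu N → ℝ) :=
  {w | InL2 Ω w ∧ ∀ s ∈ 𝒯.elements, ∃ a : ℝ,
    ∀ᵐ x ∂(volume.restrict (Ω ∩ convexHull ℝ (s : Set (Eu N)))), w x = a}

/-- `U_h`: the fields of `H(div, Ω)` whose components are polynomials of degree at most one on each
element. -/
def Uh {N : ℕ} {Ω : Set (Eu N)} (𝒯 : Mesh N Ω) : Set (Eu N → Eu N) :=
  {u | InHdiv Ω u ∧ ∀ s ∈ 𝒯.elements, ∃ A : Eu N →ᵃ[ℝ] Eu N,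
    ∀ᵐ x ∂(volume.restrict (Ω ∩ convexHull ℝ (s : Set (Eu N)))), u x = A x}

/-- `U_{h,0}`: the fields of `U_h` with `u · n = 0` on `∂Ω`. -/
def Uh0 {N : ℕ} {Ω : Set (Eu N)} (𝒯 : Mesh N Ω) : Set (Eu N → Eu N) :=
  {u | u ∈ Uh 𝒯 ∧ HasZeroNormalTrace Ω u}

/-- The two boundary conditions for the concentration (`χ = 0` and `χ = 1`). -/
inductive BC : Type
  | dirichlet : BC
  | neumann : BC

/-- The discrete flux space: `U_h` for Dirichlet, `U_{h,0}` for Neumann conditions. -/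
def Uhχ {N : ℕ} {Ω : Set (Eu N)} (χ : BC) (𝒯 : Mesh N Ω) : Set (Eu N → Eu N) :=
  match χ with
  | BC.dirichlet => Uh 𝒯
  | BC.neumann => Uh0 𝒯

/-- `W = {f ∈ H¹(Ω), (1 - χ) f ∈ H¹₀(Ω)}`. -/
def Wχ {N : ℕ} (χ : BC) (Ω : Set (Eu N)) : Set (Eu N → ℝ) :=
  match χ with
  | BC.dirichlet => {f | InH10 Ω f}
  | BC.neumann => {f | InH1 Ω f}

/-! ### The data and the scheme -/

/-- The data of the problem: the diffusion and dispersion coefficients, the retardation factor `R`,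
the porosity `ψ` with its bounds, the reaction `r`, the source `p`, the initial concentration `c₀`,
and the boundary condition. -/
structure ProblemData (N : ℕ) where
  Sm : ℝ
  αL : ℝ
  αT : ℝ
  R : ℝ
  ψ : Eu N → ℝ
  ψmin : ℝ
  ψmax : ℝ
  r : ℝ → ℝ
  p : Eu N → ℝ
  c₀ : Eu N → ℝ
  χ : BC

/-- The standing assumptions on the data. -/
structure ProblemData.Admissible {N : ℕ} (D : ProblemData N) (Ω : Set (Eu N)) : Prop where
  Sm_pos : 0 < D.Sm
  αT_nonneg : 0 ≤ D.αT
  αT_lt_αL : D.αT < D.αL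
  R_pos : 0 < D.R
  ψ_meas : AEMeasurable D.ψ (volume.restrict Ω)
  ψmin_pos : 0 < D.ψmin
  ψ_bounds : ∀ᵐ x ∂(volume.restrict Ω), D.ψmin ≤ D.ψ x ∧ D.ψ x ≤ D.ψmax
  p_mem : InL2 Ω D.p
  c₀_mem : D.c₀ ∈ Wχ D.χ Ω

/-- The matrix field `S(v_h)`. -/
def ProblemData.S {N : ℕ} (D : ProblemData N) (vh : Eu N → Eu N) :
    Eu N → Matrix (Fin N) (Fin N) ℝ :=
  fun x => dispersion D.Sm D.αL D.αT (vh x)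

/-- The matrix field `S(v_h)^{1/2}`. -/
def ProblemData.Shalf {N : ℕ} (D : ProblemData N) (vh : Eu N → Eu N) :
    Eu N → Matrix (Fin N) (Fin N) ℝ :=
  fun x => posSqrt (D.S vh x)

/-- The first equation of the scheme, for one time step from `c'` to `(c, v_c)`:
`⟨Rψ(c - c'), w⟩ + τ⟨div(S(v_h)^{1/2} v_c), w⟩ + τ⟨r(c'), w⟩ - τ⟨p, w⟩ = 0` for all `w ∈ W_h`. -/
def ConcentrationEq {N : ℕ} {Ω : Set (Eu N)} (D : ProblemData N) (𝒯 : Mesh N Ω) (τ : ℝ)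
    (vh : Eu N → Eu N) (c' c : Eu N → ℝ) (vc : Eu N → Eu N) : Prop :=
  ∀ w ∈ Wh 𝒯,
    ip Ω (fun x => D.R * D.ψ x * (c x - c' x)) w
      + τ * ip Ω (divg Ω (matAct (D.Shalf vh) vc)) w
      + τ * ip Ω (fun x => D.r (c' x)) w
      - τ * ip Ω D.p w = 0

/-- The second equation of the scheme:
`⟨S(v_h)^{-1/2} ψ⁻¹ v_c, u⟩ - ⟨c, div u⟩ - ⟨S(v_h)⁻¹ ψ⁻¹ v_h c, u⟩ = 0` for all `u` in `U_h`
(Dirichlet) or `U_{h,0}` (Neumann). -/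
def FluxEq {N : ℕ} {Ω : Set (Eu N)} (D : ProblemData N) (𝒯 : Mesh N Ω)
    (vh : Eu N → Eu N) (c : Eu N → ℝ) (vc : Eu N → Eu N) : Prop :=
  ∀ u ∈ Uhχ D.χ 𝒯,
    ip Ω (matAct (fun x => (D.Shalf vh x)⁻¹) (fun x => (D.ψ x)⁻¹ • vc x)) u
      - ip Ω c (divg Ω u)
      - ip Ω (matAct (fun x => (D.S vh x)⁻¹) (fun x => ((D.ψ x)⁻¹ * c x) • vh x)) u = 0

/-- `(c^n, v_c^n)`, `0 ≤ n ≤ M`, is a solution of the fully discrete scheme with time step `τ` and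
discrete velocity `v_h`. The initial concentration `c^0` is the `L²(Ω)`-projection of `c₀` on `W_h`,
and `v_c^0` is the flux that the second equation associates with `c^0`. The divergence of
`S(v_h)^{1/2} v_c^n` that occurs in the first equation is taken in the discrete flux space. -/
structure IsDiscreteSolution {N : ℕ} {Ω : Set (Eu N)} (D : ProblemData N) (𝒯 : Mesh N Ω)
    (τ : ℝ) (M : ℕ) (vh : Eu N → Eu N) (c : ℕ → Eu N → ℝ) (vc : ℕ → Eu N → Eu N) : Prop where
  c_mem : ∀ n ≤ M, c n ∈ Wh 𝒯
  vc_mem : ∀ n ≤ M, InL2 Ω (vc n)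
  flux_mem : ∀ n ≤ M, matAct (D.Shalf vh) (vc n) ∈ Uhχ D.χ 𝒯
  initial : ∀ w ∈ Wh 𝒯, ip Ω (fun x => c 0 x - D.c₀ x) w = 0
  concentration : ∀ n, 1 ≤ n → n ≤ M → ConcentrationEq D 𝒯 τ vh (c (n - 1)) (c n) (vc n)
  flux : ∀ n ≤ M, FluxEq D 𝒯 vh (c n) (vc n)

end

/-! ### The dispersion tensor, its square root and the drift field -/

noncomputable section

/-! Write q^n for the discrete flux, d^n for the divergence of S(v_h)^{1/2} q^n, V for the sup norm
of v_h, and E^n for the integral of ψ⁻¹|q^n|². The vector v is an eigenvector of S(v) with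
eigenvalue S_m + α_L|v|. Hence the drift g = S(v_h)^{-1/2} v_h is explicit and |g|² ≤ V/α_L, linear
in V (`norm_drift_sq_le`). Testing the flux equation with S(v_h)^{1/2} q removes the tensor
(`FluxEq.integral_eq`). In each estimate below, the term pairing d with a concentration then cancels
or can be integrated by parts.

Energy (`energy_step`): testing the concentration equation with c^n bounds the sum of τE^n by a
multiple of 1 + V. The assumed bound K controls c^n and the reaction, so no Gronwall argument is
needed.

Increments (`increment_step`): the concentration equation is tested with c^n - c^{n-1}, and the flux
equations at times n and n-1 are both tested with S(v_h)^{1/2} q^n and subtracted. Polarization of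
q^n·(q^n - q^{n-1}) makes E^n telescope. Young's inequality turns the drift term into a part
absorbed by |c^n - c^{n-1}|²/τ and a multiple of V τE^n, whose sum is of order V(1 + V) by the
energy estimate. This is the source of the power V².

Initial flux (`initial_flux_bound`): d^0 lies in W_h, so in its pairing with c^0 the projection can
be replaced by c₀. Integration by parts against the gradient of c₀ and |S^{1/2}q|² ≤ (S_m + α_L
V)|q|² give E^0 of order 1 + V. The boundary term vanishes by density of test functions (Dirichlet)
or by the zero normal trace (Neumann).

Divergence (`divergence_step`): since d^n is in W_h (`divg_mem_Wh`), it is itself an admissible test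
function, and the increment estimate bounds the result. -/

/-- The eigenvalue of the dispersion tensor `S(v)` in the direction of `v`. -/
def longitudinal {N : ℕ} (Sm αL : ℝ) (v : Eu N) : ℝ := Sm + αL * ‖v‖

theorem toEuclideanLin_mul_apply {N : ℕ} (A B : Matrix (Fin N) (Fin N) ℝ) (q : Eu N) :
    Matrix.toEuclideanLin (A * B) q = Matrix.toEuclideanLin A (Matrix.toEuclideanLin B q) := by
  simp [Matrix.toLpLin_apply, Matrix.mulVec_mulVec]

theorem toEuclideanLin_one_apply {N : ℕ} (q : Eu N) :
    Matrix.toEuclideanLin (1 : Matrix (Fin N) (Fin N) ℝ) q = q := by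
  simp [Matrix.toLpLin_apply]

theorem inner_toEuclideanLin_of_isHermitian {N : ℕ} {X : Matrix (Fin N) (Fin N) ℝ}
    (hX : X.IsHermitian) (a b : Eu N) :
    inner ℝ (Matrix.toEuclideanLin X a) b = inner ℝ a (Matrix.toEuclideanLin X b) :=
  Matrix.isSymmetric_toEuclideanLin_iff.2 hX a b

theorem dispersion_apply {N : ℕ} (Sm αL αT : ℝ) (v q : Eu N) :
    Matrix.toEuclideanLin (dispersion Sm αL αT v) q =
      (Sm + ‖v‖ * αT) • q + (‖v‖ * ((αL - αT) / ‖v‖ ^ 2) * inner ℝ v q) • v := by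
  ext i
  simp only [dispersion, map_add, map_smul, map_sub, LinearMap.add_apply, LinearMap.smul_apply,
    LinearMap.sub_apply, toEuclideanLin_one_apply, PiLp.add_apply, PiLp.smul_apply, PiLp.sub_apply,
    smul_eq_mul]
  have h : (Matrix.toEuclideanLin (Matrix.vecMulVec v.ofLp v.ofLp) q) i = inner ℝ v q * v i := by
    simp [Matrix.toLpLin_apply, Matrix.vecMulVec_mulVec, PiLp.inner_apply, dotProduct, mul_comm]
  rw [h]
  ring

theorem dispersion_apply_self {N : ℕ} (Sm αL αT : ℝ) (v : Eu N) :
    Matrix.toEuclideanLin (dispersion Sm αL αT v) v = longitudinal Sm αL v • v := by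
  rw [dispersion_apply, ← add_smul, longitudinal, real_inner_self_eq_norm_sq]
  by_cases hv : ‖v‖ = 0
  · rw [norm_eq_zero.1 hv]; simp
  · congr 1
    field_simp
    ring

/-- By Cauchy–Schwarz for v and q: as α_T ≤ α_L, the direction of v carries the largest eigenvalue.
-/
theorem inner_dispersion_le {N : ℕ} {Sm αL αT : ℝ} (hα : αT ≤ αL) (v q : Eu N) :
    inner ℝ q (Matrix.toEuclideanLin (dispersion Sm αL αT v) q) ≤
      longitudinal Sm αL v * ‖q‖ ^ 2 := by
  rw [dispersion_apply, inner_add_right, inner_smul_right, inner_smul_right,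
    real_inner_self_eq_norm_sq, real_inner_comm v q, longitudinal]
  by_cases hv : ‖v‖ = 0
  · simp [hv]
  · have hv' : 0 < ‖v‖ := lt_of_le_of_ne (norm_nonneg v) (Ne.symm hv)
    have hcs : inner ℝ v q * inner ℝ v q ≤ ‖v‖ ^ 2 * ‖q‖ ^ 2 := by
      have h := abs_real_inner_le_norm v q
      have h2 := mul_self_le_mul_self (abs_nonneg _) h
      rw [abs_mul_abs_self] at h2
      linarith
    have h1 : ‖v‖ * ((αL - αT) / ‖v‖ ^ 2) * inner ℝ v q * inner ℝ v q ≤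
        ‖v‖ * ((αL - αT) / ‖v‖ ^ 2) * (‖v‖ ^ 2 * ‖q‖ ^ 2) := by
      rw [mul_assoc]
      have : 0 ≤ αL - αT := sub_nonneg.2 hα
      gcongr
    have h2 : ‖v‖ * ((αL - αT) / ‖v‖ ^ 2) * (‖v‖ ^ 2 * ‖q‖ ^ 2) =
        ‖v‖ * (αL - αT) * ‖q‖ ^ 2 := by
      field_simp
    linarith

theorem IsPosSqrt.isUnit_det {N : ℕ} {A X : Matrix (Fin N) (Fin N) ℝ} (h : IsPosSqrt A X) :
    IsUnit X.det :=
  h.1.det_pos.ne'.isUnit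

theorem IsPosSqrt.inner_inv_apply {N : ℕ} {A X : Matrix (Fin N) (Fin N) ℝ} (h : IsPosSqrt A X)
    (a b : Eu N) :
    inner ℝ (Matrix.toEuclideanLin X⁻¹ a) (Matrix.toEuclideanLin X b) = inner ℝ a b := by
  rw [← inner_toEuclideanLin_of_isHermitian h.1.isHermitian, ← toEuclideanLin_mul_apply,
    Matrix.mul_nonsing_inv _ h.isUnit_det, toEuclideanLin_one_apply]

theorem IsPosSqrt.inner_inv_sq_apply {N : ℕ} {A X : Matrix (Fin N) (Fin N) ℝ}
    (h : IsPosSqrt A X) (a b : Eu N) :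
    inner ℝ (Matrix.toEuclideanLin A⁻¹ a) (Matrix.toEuclideanLin X b) =
      inner ℝ (Matrix.toEuclideanLin X⁻¹ a) b := by
  rw [← h.2, Matrix.mul_inv_rev, toEuclideanLin_mul_apply, h.inner_inv_apply]

theorem IsPosSqrt.norm_sq_apply {N : ℕ} {A X : Matrix (Fin N) (Fin N) ℝ} (h : IsPosSqrt A X)
    (q : Eu N) :
    ‖Matrix.toEuclideanLin X q‖ ^ 2 = inner ℝ q (Matrix.toEuclideanLin A q) := by
  rw [← real_inner_self_eq_norm_sq, inner_toEuclideanLin_of_isHermitian h.1.isHermitian,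
    ← toEuclideanLin_mul_apply, h.2]

/-- The defect w = Xv - √l v satisfies Xw = -√l w, which positivity of X allows only for w = 0. This
works for any positive root, so neither uniqueness of the root nor a diagonalization is needed. -/
theorem IsPosSqrt.inv_apply_of_eigenvector {N : ℕ} {A X : Matrix (Fin N) (Fin N) ℝ}
    (h : IsPosSqrt A X) {l : ℝ} (hl : 0 < l) {v : Eu N}
    (hv : Matrix.toEuclideanLin A v = l • v) :
    Matrix.toEuclideanLin X⁻¹ v = (Real.sqrt l)⁻¹ • v := by
  have hs : 0 < Real.sqrt l := Real.sqrt_pos.2 hl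
  set w : Eu N := Matrix.toEuclideanLin X v - Real.sqrt l • v with hw
  have h1 : Matrix.toEuclideanLin X w = - (Real.sqrt l • w) := by
    rw [hw, map_sub, map_smul, ← toEuclideanLin_mul_apply, h.2, hv, smul_sub, smul_smul,
      Real.mul_self_sqrt hl.le]
    abel
  have h2 : 0 ≤ inner ℝ w (Matrix.toEuclideanLin X w) := by
    have := h.1.posSemidef.dotProduct_mulVec_nonneg w.ofLp
    simpa [PiLp.inner_apply, Matrix.toLpLin_apply, dotProduct, mul_comm] using this
  have h3 : w = 0 := by
    rw [h1, inner_neg_right, inner_smul_right, real_inner_self_eq_norm_sq] at h2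
    have : ‖w‖ ^ 2 ≤ 0 := by
      by_contra hc
      push Not at hc
      have := mul_pos hs hc
      linarith
    exact norm_eq_zero.1 (pow_eq_zero_iff two_ne_zero |>.1 (le_antisymm this (by positivity)))
  have h4 : Matrix.toEuclideanLin X v = Real.sqrt l • v := sub_eq_zero.1 h3
  have h5 : Matrix.toEuclideanLin X⁻¹ (Matrix.toEuclideanLin X v) = v := by
    rw [← toEuclideanLin_mul_apply, Matrix.nonsing_inv_mul _ h.isUnit_det,
      toEuclideanLin_one_apply]
  rw [h4, map_smul] at h5
  rw [eq_inv_smul_iff₀ hs.ne', h5]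

/-- The drift field `S(v)^{-1/2} v`. -/
def drift {N : ℕ} (Sm αL : ℝ) (v : Eu N) : Eu N := (Real.sqrt (longitudinal Sm αL v))⁻¹ • v

/-- Gives the measurability of S(v_h)^{-1/2} v_h. The square root is a pointwise choice, but on v
itself its inverse acts by an explicit scalar, continuous because S_m > 0. -/
theorem continuous_drift {N : ℕ} {Sm αL : ℝ} (hSm : 0 < Sm) (hα : 0 ≤ αL) :
    Continuous (drift (N := N) Sm αL) := by
  unfold drift longitudinal
  have h : Continuous fun v : Eu N => Real.sqrt (Sm + αL * ‖v‖) := by fun_prop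
  refine (h.inv₀ fun v => ?_).smul continuous_id
  exact (Real.sqrt_pos.2 (by positivity)).ne'

/-- The longitudinal dispersion α_L|v| in the denominator cancels one power of |v|; using S_m alone
would leave |v|². -/
theorem norm_drift_sq_le {N : ℕ} {Sm αL : ℝ} (hSm : 0 < Sm) (hα : 0 < αL) (v : Eu N) :
    ‖drift Sm αL v‖ ^ 2 ≤ ‖v‖ / αL := by
  have hl : 0 < longitudinal Sm αL v := by unfold longitudinal; positivity
  rw [drift, norm_smul, mul_pow, norm_inv, inv_pow, Real.norm_eq_abs, sq_abs,
    Real.sq_sqrt hl.le, inv_mul_le_iff₀ hl, mul_div_assoc', le_div_iff₀ hα, longitudinal]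
  nlinarith [norm_nonneg v]

/-! ### Test functions and weak derivatives -/

theorem gradient_eq_toDual_symm_comp {N : ℕ} (φ : Eu N → ℝ) :
    gradient φ = fun x => (InnerProductSpace.toDual ℝ (Eu N)).symm (fderiv ℝ φ x) := rfl

theorem IsTestFunction.continuous_gradient {N : ℕ} {Ω : Set (Eu N)} {φ : Eu N → ℝ}
    (h : IsTestFunction Ω φ) : Continuous (gradient φ) := by
  rw [gradient_eq_toDual_symm_comp]
  exact (LinearIsometryEquiv.continuous _).comp (h.1.continuous_fderiv (by simp))

theorem IsTestFunction.hasCompactSupport_gradient {N : ℕ} {Ω : Set (Eu N)} {φ : Eu N → ℝ}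
    (h : IsTestFunction Ω φ) : HasCompactSupport (gradient φ) := by
  rw [gradient_eq_toDual_symm_comp]
  exact (h.2.1.fderiv (𝕜 := ℝ)).comp_left (map_zero _)

theorem gradient_eq_zero_of_notMem_tsupport {N : ℕ} {φ : Eu N → ℝ} {x : Eu N}
    (hx : x ∉ tsupport φ) : gradient φ x = 0 := by
  have h : fderiv ℝ φ x = 0 := by
    by_contra hc
    exact hx (support_fderiv_subset ℝ hc)
  rw [gradient, h, map_zero]

/-- The trace of the linear part of an affine map, which is its divergence. -/
def affineDiv {N : ℕ} (A : Eu N →ᵃ[ℝ] Eu N) : ℝ :=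
  ∑ i, A.linear (EuclideanSpace.single i 1) i

/-- Componentwise integration by parts on the whole space: the partial derivatives of an affine map
are constant, and the compact support of φ makes every product integrable. -/
theorem integral_inner_affine_gradient {N : ℕ} (A : Eu N →ᵃ[ℝ] Eu N) {Ω : Set (Eu N)}
    {φ : Eu N → ℝ} (h : IsTestFunction Ω φ) :
    ∫ x, inner ℝ (A x) (gradient φ x) = - ∫ x, affineDiv A * φ x := by
  have hA : Continuous A := A.continuous_of_finiteDimensional
  have hdφ : Continuous (fderiv ℝ φ) := h.1.continuous_fderiv (by simp)
  have hd : ∀ i : Fin N, ∀ x, HasFDerivAt (fun x => A x i)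
      ((EuclideanSpace.proj (𝕜 := ℝ) i).comp (LinearMap.toContinuousLinearMap A.linear)) x := by
    intro i x
    have hAd : HasFDerivAt A (LinearMap.toContinuousLinearMap A.linear) x := by
      have h1 := (LinearMap.toContinuousLinearMap A.linear).hasFDerivAt (x := x)
      have h2 := h1.add_const (A 0)
      refine h2.congr_of_eventuallyEq (Filter.Eventually.of_forall fun y => ?_)
      have := congrFun A.decomp y
      simpa using this
    exact (EuclideanSpace.proj (𝕜 := ℝ) i).hasFDerivAt.comp x hAd
  have key : ∀ i : Fin N, ∫ x, A x i * fderiv ℝ φ x (EuclideanSpace.single i 1)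
      = - ∫ x, A.linear (EuclideanSpace.single i 1) i * φ x := by
    intro i
    have hAi : Continuous fun x => A x i := (EuclideanSpace.proj (𝕜 := ℝ) i).continuous.comp hA
    have hfd : ∀ x, fderiv ℝ (fun x => A x i) x (EuclideanSpace.single i 1)
        = A.linear (EuclideanSpace.single i 1) i := by
      intro x
      rw [(hd i x).fderiv]
      rfl
    have hsupp : HasCompactSupport fun x => fderiv ℝ φ x (EuclideanSpace.single i 1) :=
      h.2.1.fderiv_apply (𝕜 := ℝ) _
    rw [integral_mul_fderiv_eq_neg_fderiv_mul_of_integrable]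
    · simp_rw [hfd]
    · simp_rw [hfd]
      exact (h.1.continuous.integrable_of_hasCompactSupport h.2.1).const_mul _
    · exact (hAi.mul (hdφ.clm_apply continuous_const)).integrable_of_hasCompactSupport
        hsupp.mul_left
    · exact (hAi.mul h.1.continuous).integrable_of_hasCompactSupport h.2.1.mul_left
    · exact fun x _ => (hd i x).differentiableAt
    · exact fun x _ => (h.1.differentiable (by simp)) x
  have hexp : ∀ x, inner ℝ (A x) (gradient φ x)
      = ∑ i, A x i * fderiv ℝ φ x (EuclideanSpace.single i 1) := by
    intro x
    have hx : ∑ i, A x i • EuclideanSpace.single i (1 : ℝ) = A x := by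
      ext j
      simp [Finset.sum_apply, Pi.single_apply]
    rw [inner_gradient_right]
    conv_lhs => rw [← hx]
    simp
  simp_rw [hexp, affineDiv]
  rw [integral_finsetSum]
  · simp_rw [key, Finset.sum_neg_distrib, Finset.sum_mul]
    rw [integral_finsetSum]
    exact fun i _ => (h.1.continuous.integrable_of_hasCompactSupport h.2.1).const_mul _
  · intro i _
    have hAi : Continuous fun x => A x i := (EuclideanSpace.proj (𝕜 := ℝ) i).continuous.comp hA
    have hsupp : HasCompactSupport fun x => fderiv ℝ φ x (EuclideanSpace.single i 1) :=
      h.2.1.fderiv_apply (𝕜 := ℝ) _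
    exact (hAi.mul (hdφ.clm_apply continuous_const)).integrable_of_hasCompactSupport
        hsupp.mul_left

/-! ### Meshes -/

theorem Mesh.ae_restrict {N : ℕ} {Ω : Set (Eu N)} (𝒯 : Mesh N Ω) {p : Eu N → Prop}
    (h : ∀ s ∈ 𝒯.elements,
      ∀ᵐ x ∂(volume.restrict (Ω ∩ convexHull ℝ (s : Set (Eu N)))), p x) :
    ∀ᵐ x ∂(volume.restrict Ω), p x := by
  have hsub : Ω ⊆ ⋃ s ∈ 𝒯.elements, Ω ∩ convexHull ℝ (s : Set (Eu N)) := by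
    intro x hx
    have hx' := subset_closure hx
    rw [← 𝒯.cover] at hx'
    simp only [Set.mem_iUnion] at hx' ⊢
    obtain ⟨s, hs, hxs⟩ := hx'
    exact ⟨s, hs, hx, hxs⟩
  exact ae_restrict_of_ae_restrict_of_subset hsub
    ((ae_restrict_biUnion_finset_iff _ _ _).2 h)

theorem Mesh.aestronglyMeasurable {N : ℕ} {Ω : Set (Eu N)} (𝒯 : Mesh N Ω) {f : Eu N → ℝ}
    (h : ∀ s ∈ 𝒯.elements,
      AEStronglyMeasurable f (volume.restrict (Ω ∩ convexHull ℝ (s : Set (Eu N))))) :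
    AEStronglyMeasurable f (volume.restrict Ω) := by
  have hsub : Ω ⊆ ⋃ s : 𝒯.elements, Ω ∩ convexHull ℝ ((s : Finset (Eu N)) : Set (Eu N)) := by
    intro x hx
    have hx' := subset_closure hx
    rw [← 𝒯.cover] at hx'
    simp only [Set.mem_iUnion] at hx' ⊢
    obtain ⟨s, hs, hxs⟩ := hx'
    exact ⟨⟨s, hs⟩, hx, hxs⟩
  exact (AEStronglyMeasurable.iUnion fun s : 𝒯.elements => h s s.2).mono_measure
    (Measure.restrict_mono hsub le_rfl)

/-- Composition with r keeps a function constant on each of finitely many elements. This gives both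
measurability and boundedness, with no regularity assumed of r. -/
theorem comp_mem_Wh {N : ℕ} {Ω : Set (Eu N)} (hΩ : Bornology.IsBounded Ω) {𝒯 : Mesh N Ω}
    (r : ℝ → ℝ) {w : Eu N → ℝ} (hw : w ∈ Wh 𝒯) : (fun x => r (w x)) ∈ Wh 𝒯 := by
  have : IsFiniteMeasure (volume.restrict Ω) := ⟨by
    rw [Measure.restrict_apply_univ]; exact hΩ.measure_lt_top⟩
  have hc : ∀ s ∈ 𝒯.elements, ∃ a : ℝ,
      ∀ᵐ x ∂(volume.restrict (Ω ∩ convexHull ℝ (s : Set (Eu N)))), r (w x) = a := by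
    intro s hs
    obtain ⟨a, ha⟩ := hw.2 s hs
    exact ⟨r a, ha.mono fun x hx => by rw [hx]⟩
  refine ⟨?_, hc⟩
  choose! a ha using hc
  refine MemLp.of_bound (𝒯.aestronglyMeasurable fun s hs => ?_) (∑ s ∈ 𝒯.elements, |a s|)
    (𝒯.ae_restrict fun s hs => ?_)
  · exact aestronglyMeasurable_const.congr ((ha s hs).mono fun x hx => hx.symm)
  · filter_upwards [ha s hs] with x hx
    rw [hx, Real.norm_eq_abs]
    exact Finset.single_le_sum (f := fun s => |a s|) (fun i _ => abs_nonneg _) hs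

/-- Inside an element the field is affine, so test functions supported there identify the weak
divergence with the trace of the linear part. What remains of the element lies in its boundary, a
null set by convexity. -/
theorem divg_mem_Wh {N : ℕ} {Ω : Set (Eu N)} (hΩ : IsOpen Ω) {𝒯 : Mesh N Ω}
    {u : Eu N → Eu N} (hu : u ∈ Uh 𝒯) : divg Ω u ∈ Wh 𝒯 := by
  obtain ⟨hu2, hd2, hdiv⟩ := hasWeakDiv_divg hu.1
  refine ⟨hd2, fun s hs => ?_⟩
  obtain ⟨A, hA⟩ := hu.2 s hs
  refine ⟨affineDiv A, ?_⟩
  set H := convexHull ℝ (s : Set (Eu N)) with hH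
  set U := Ω ∩ interior H with hUdef
  have hU : IsOpen U := hΩ.inter isOpen_interior
  have hAU : ∀ᵐ x, x ∈ U → u x = A x := by
    rw [← ae_restrict_iff' hU.measurableSet]
    exact ae_restrict_of_ae_restrict_of_subset
      (Set.inter_subset_inter_right _ interior_subset) hA
  have hloc : LocallyIntegrableOn (divg Ω u) U := by
    refine LocallyIntegrableOn.mono_set ?_ (Set.inter_subset_left : U ⊆ Ω)
    exact locallyIntegrableOn_of_locallyIntegrable_restrict
      (MemLp.locallyIntegrable hd2 (by norm_num))
  -- Fundamental lemma of the calculus of variations on the part of Ω interior to the element.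
  have hae : ∀ᵐ x, x ∈ U → divg Ω u x - affineDiv A = 0 := by
    refine hU.ae_eq_zero_of_integral_contDiff_smul_eq_zero
      (hloc.sub ((locallyIntegrable_const _).locallyIntegrableOn U)) fun φ hφ hφc hφU => ?_
    have hφΩ : tsupport φ ⊆ Ω := hφU.trans Set.inter_subset_left
    have hφt : IsTestFunction Ω φ := ⟨hφ, hφc, hφΩ⟩
    have h0 : ∀ x, x ∉ Ω → φ x = 0 := fun x hx =>
      image_eq_zero_of_notMem_tsupport fun h => hx (hφΩ h)
    have h1 := hdiv φ hφt
    rw [setIntegral_eq_integral_of_forall_compl_eq_zero fun x hx => by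
        rw [gradient_eq_zero_of_notMem_tsupport fun h => hx (hφΩ h), inner_zero_right],
      setIntegral_eq_integral_of_forall_compl_eq_zero fun x hx => by rw [h0 x hx, mul_zero]] at h1
    have h2 : ∫ x, inner ℝ (u x) (gradient φ x) = ∫ x, inner ℝ (A x) (gradient φ x) := by
      refine integral_congr_ae (hAU.mono fun x hx => ?_)
      by_cases hxU : x ∈ U
      · simp only [hx hxU]
      · simp only [gradient_eq_zero_of_notMem_tsupport fun h => hxU (hφU h), inner_zero_right]
    rw [h2, integral_inner_affine_gradient A hφt, neg_inj] at h1
    have hint : Integrable fun x => divg Ω u x * φ x := by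
      have h3 : IntegrableOn (fun x => divg Ω u x * φ x) Ω :=
        MemLp.integrable_mul (p := 2) (q := 2) hd2
          (hφ.continuous.memLp_of_hasCompactSupport hφc)
      refine (integrableOn_iff_integrable_of_support_subset fun x hx => ?_).1 h3
      by_contra hc
      exact hx (by simp [h0 x hc])
    have h4 : ∀ x, φ x • (divg Ω u x - affineDiv A) = divg Ω u x * φ x - affineDiv A * φ x := by
      intro x; rw [smul_eq_mul]; ring
    simp_rw [h4]
    rw [integral_sub hint ((hφ.continuous.integrable_of_hasCompactSupport hφc).const_mul _), h1,
      sub_self]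
  have hfr : volume (frontier H) = 0 := (convex_convexHull ℝ _).addHaar_frontier volume
  have hHm : MeasurableSet H :=
    (s.finite_toSet.isCompact_convexHull ℝ).isClosed.measurableSet
  rw [ae_restrict_iff' (hΩ.measurableSet.inter hHm)]
  filter_upwards [hae, measure_eq_zero_iff_ae_notMem.1 hfr] with x hx hxf hxm
  have hxi : x ∈ interior H := by
    by_contra hc
    exact hxf ⟨subset_closure hxm.2, hc⟩
  exact sub_eq_zero.1 (hx ⟨hxm.1, hxi⟩)

/-- Affine maps are bounded on the compact simplices, so the essential supremum is finite.
Finiteness must be checked because `toReal` sends an infinite norm to 0. -/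
theorem linfnorm_bound_of_mem_Uh {N : ℕ} {Ω : Set (Eu N)} {𝒯 : Mesh N Ω}
    {u : Eu N → Eu N} (hu : u ∈ Uh 𝒯) :
    ∀ᵐ x ∂(volume.restrict Ω), ‖u x‖ ≤ linfnorm Ω u := by
  have hb : ∀ s ∈ 𝒯.elements, ∃ b : ℝ, 0 ≤ b ∧
      ∀ᵐ x ∂(volume.restrict (Ω ∩ convexHull ℝ (s : Set (Eu N)))), ‖u x‖ ≤ b := by
    intro s hs
    obtain ⟨A, hA⟩ := hu.2 s hs
    obtain ⟨b, hb⟩ := (s.finite_toSet.isCompact_convexHull ℝ).exists_bound_of_continuousOn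
      A.continuous_of_finiteDimensional.continuousOn
    refine ⟨max b 0, le_max_right _ _, ?_⟩
    have hHm : MeasurableSet (convexHull ℝ (s : Set (Eu N))) :=
      (s.finite_toSet.isCompact_convexHull ℝ).isClosed.measurableSet
    have hm : ∀ᵐ x ∂(volume.restrict (Ω ∩ convexHull ℝ (s : Set (Eu N)))),
        x ∈ convexHull ℝ (s : Set (Eu N)) :=
      ae_restrict_of_ae_restrict_of_subset Set.inter_subset_right (ae_restrict_mem hHm)
    filter_upwards [hA, hm] with x hx hxm
    rw [hx]
    exact (hb x hxm).trans (le_max_left _ _)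
  choose! b hb0 hb using hb
  have hbd : ∀ᵐ x ∂(volume.restrict Ω), ‖u x‖ ≤ ∑ s ∈ 𝒯.elements, b s :=
    𝒯.ae_restrict fun s hs => (hb s hs).mono fun x hx =>
      hx.trans (Finset.single_le_sum (f := b) (fun i hi => hb0 i hi) hs)
  have hfin : eLpNormEssSup u (volume.restrict Ω) < ⊤ := eLpNormEssSup_lt_top_of_ae_bound hbd
  filter_upwards [ae_le_eLpNormEssSup (f := u) (μ := volume.restrict Ω)] with x hx
  rw [linfnorm, eLpNorm_exponent_top, ← toReal_enorm]
  exact ENNReal.toReal_mono hfin.ne hx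

/-! ### Inner products and norms in `L²(Ω)` -/

theorem l2norm_sq {N : ℕ} {F : Type*} [NormedAddCommGroup F] {Ω : Set (Eu N)} {f : Eu N → F}
    (hf : InL2 Ω f) : l2norm Ω f ^ 2 = ∫ x in Ω, ‖f x‖ ^ 2 := by
  have h := hf.eLpNorm_eq_integral_rpow_norm (by norm_num) (by norm_num)
  have h0 : 0 ≤ ∫ x in Ω, ‖f x‖ ^ 2 := integral_nonneg fun x => by positivity
  simp only [ENNReal.toReal_ofNat, Real.rpow_two] at h
  rw [l2norm, h, ENNReal.toReal_ofReal (by positivity), ← Real.rpow_natCast, ← Real.rpow_mul h0]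
  norm_num

theorem MeasureTheory.MemLp.integrable_real_inner {X : Type*} [MeasurableSpace X]
    {μ : Measure X} {F : Type*} [NormedAddCommGroup F] [InnerProductSpace ℝ F] {f g : X → F}
    (hf : MemLp f 2 μ) (hg : MemLp g 2 μ) :
    Integrable (fun x => (inner ℝ (f x) (g x) : ℝ)) μ := by
  refine (L2.integrable_inner (𝕜 := ℝ) (hf.toLp f) (hg.toLp g)).congr ?_
  filter_upwards [hf.coeFn_toLp, hg.coeFn_toLp] with x h1 h2
  rw [h1, h2]

theorem InL2.abs_integral_inner_le {N : ℕ} {F : Type*} [NormedAddCommGroup F]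
    [InnerProductSpace ℝ F] {Ω : Set (Eu N)} {f g : Eu N → F} (hf : InL2 Ω f) (hg : InL2 Ω g) :
    |∫ x in Ω, (inner ℝ (f x) (g x) : ℝ)| ≤ l2norm Ω f * l2norm Ω g := by
  have hf' : MemLp f 2 (volume.restrict Ω) := hf
  have hg' : MemLp g 2 (volume.restrict Ω) := hg
  have h := abs_real_inner_le_norm (hf'.toLp f) (hg'.toLp g)
  rw [L2.inner_def, Lp.norm_toLp, Lp.norm_toLp] at h
  refine le_trans (le_of_eq ?_) h
  congr 1
  refine integral_congr_ae ?_
  filter_upwards [hf'.coeFn_toLp, hg'.coeFn_toLp] with x h1 h2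
  rw [h1, h2]

/-- Integration by parts between `H¹₀(Ω)` and `H(div, Ω)`. -/
theorem integral_inner_grad_of_InH10 {N : ℕ} {Ω : Set (Eu N)} {f : Eu N → ℝ} {G : Eu N → Eu N}
    (hfG : HasWeakGrad Ω f G)
    (happ : ∀ ε : ℝ, 0 < ε → ∃ φ : Eu N → ℝ, IsTestFunction Ω φ ∧
      l2norm Ω (fun x => f x - φ x) < ε ∧ l2norm Ω (fun x => G x - gradient φ x) < ε)
    {q : Eu N → Eu N} {d : Eu N → ℝ} (hq : HasWeakDiv Ω q d) :
    (∫ x in Ω, inner ℝ (q x) (G x)) + ∫ x in Ω, d x * f x = 0 := by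
  -- This defect vanishes for test functions and is continuous in (f, G) for the L² norms, so it is
  -- smaller than any multiple of ε.
  set I := (∫ x in Ω, inner ℝ (q x) (G x)) + ∫ x in Ω, d x * f x with hI
  obtain ⟨hq2, hd2, hdiv⟩ := hq
  have hle : ∀ ε : ℝ, 0 < ε → |I| ≤ (l2norm Ω q + l2norm Ω d) * ε := by
    intro ε hε
    obtain ⟨φ, hφ, h1, h2⟩ := happ ε hε
    have hφ2 : InL2 Ω φ := hφ.1.continuous.memLp_of_hasCompactSupport hφ.2.1
    have hgφ : InL2 Ω (gradient φ) :=
      hφ.continuous_gradient.memLp_of_hasCompactSupport hφ.hasCompactSupport_gradient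
    have e1 : ∫ x in Ω, inner ℝ (q x) (G x - gradient φ x) =
        (∫ x in Ω, inner ℝ (q x) (G x)) - ∫ x in Ω, inner ℝ (q x) (gradient φ x) := by
      simp_rw [inner_sub_right]
      exact integral_sub (MemLp.integrable_real_inner hq2 hfG.2.1)
        (MemLp.integrable_real_inner hq2 hgφ)
    have e2 : ∫ x in Ω, inner ℝ (d x) (f x - φ x) =
        (∫ x in Ω, d x * f x) - ∫ x in Ω, d x * φ x := by
      have : ∀ x, (inner ℝ (d x) (f x - φ x) : ℝ) = d x * f x - d x * φ x := fun x => by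
        simp; ring
      simp_rw [this]
      exact integral_sub (hd2.integrable_mul hfG.1) (hd2.integrable_mul hφ2)
    have hIe : I = (∫ x in Ω, inner ℝ (q x) (G x - gradient φ x)) +
        ∫ x in Ω, inner ℝ (d x) (f x - φ x) := by
      rw [e1, e2, hdiv φ hφ, hI]; ring
    have hG' : InL2 Ω fun x => G x - gradient φ x := hfG.2.1.sub hgφ
    have hf' : InL2 Ω fun x => f x - φ x := hfG.1.sub hφ2
    calc |I| ≤ l2norm Ω q * l2norm Ω (fun x => G x - gradient φ x) +
          l2norm Ω d * l2norm Ω (fun x => f x - φ x) := by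
          rw [hIe]
          exact (abs_add_le _ _).trans
            (add_le_add (hq2.abs_integral_inner_le hG') (hd2.abs_integral_inner_le hf'))
      _ ≤ l2norm Ω q * ε + l2norm Ω d * ε := by
          have hq0 : 0 ≤ l2norm Ω q := ENNReal.toReal_nonneg
          have hd0 : 0 ≤ l2norm Ω d := ENNReal.toReal_nonneg
          gcongr
      _ = (l2norm Ω q + l2norm Ω d) * ε := by ring
  have hB : 0 ≤ l2norm Ω q + l2norm Ω d := add_nonneg ENNReal.toReal_nonneg ENNReal.toReal_nonneg
  by_contra hne
  have hpos : 0 < |I| := abs_pos.2 hne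
  have h := hle (|I| / (2 * (l2norm Ω q + l2norm Ω d + 1))) (by positivity)
  rw [mul_div_assoc', le_div_iff₀ (by positivity)] at h
  nlinarith

/-! ### Integrated energy inequalities -/

/-- Reduces an inequality between integrals to a pointwise one: the energy estimates below list
their integrands and coefficients once, then check integrability and the sign of the sum separately.
-/
theorem sum_mul_integral_nonneg {X : Type*} [MeasurableSpace X] {μ : Measure X} {n : ℕ}
    (a : Fin n → ℝ) (f : Fin n → X → ℝ) (hf : ∀ i, Integrable (f i) μ)
    (h : ∀ᵐ x ∂μ, 0 ≤ ∑ i, a i * f i x) : 0 ≤ ∑ i, a i * ∫ x, f i x ∂μ := by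
  have h1 : ∫ x, ∑ i, a i * f i x ∂μ = ∑ i, a i * ∫ x, f i x ∂μ := by
    rw [integral_finsetSum _ fun i _ => (hf i).const_mul (a i)]
    simp_rw [integral_const_mul]
  rw [← h1]
  exact integral_nonneg_of_ae h

/-- `ψ` is measurable with `0 < m ≤ ψ ≤ M` almost everywhere. -/
structure IsWeight {X : Type*} [MeasurableSpace X] (μ : Measure X) (ψ : X → ℝ) (m M : ℝ) :
    Prop where
  pos : 0 < m
  meas : AEMeasurable ψ μ
  bounds : ∀ᵐ x ∂μ, m ≤ ψ x ∧ ψ x ≤ M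

section Weight

variable {X : Type*} [MeasurableSpace X] {μ : Measure X} {ψ : X → ℝ} {m M : ℝ}

theorem IsWeight.integrable_mul (hψ : IsWeight μ ψ m M) {f : X → ℝ} (hf : Integrable f μ) :
    Integrable (fun x => ψ x * f x) μ := by
  refine hf.bdd_mul (c := M) hψ.meas.aestronglyMeasurable ?_
  filter_upwards [hψ.bounds] with x hx
  rw [Real.norm_eq_abs, abs_of_pos (hψ.pos.trans_le hx.1)]
  exact hx.2

theorem IsWeight.integrable_inv_mul (hψ : IsWeight μ ψ m M) {f : X → ℝ} (hf : Integrable f μ) :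
    Integrable (fun x => (ψ x)⁻¹ * f x) μ := by
  refine hf.bdd_mul (c := m⁻¹) hψ.meas.inv.aestronglyMeasurable ?_
  filter_upwards [hψ.bounds] with x hx
  rw [norm_inv, Real.norm_eq_abs, abs_of_pos (hψ.pos.trans_le hx.1)]
  exact inv_anti₀ hψ.pos hx.1

theorem IsWeight.integral_mul_le (hψ : IsWeight μ ψ m M) {f : X → ℝ} (hf : Integrable f μ)
    (h0 : ∀ x, 0 ≤ f x) : ∫ x, ψ x * f x ∂μ ≤ M * ∫ x, f x ∂μ := by
  rw [← integral_const_mul]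
  refine integral_mono_ae (hψ.integrable_mul hf) (hf.const_mul M) ?_
  filter_upwards [hψ.bounds] with x hx
  exact mul_le_mul_of_nonneg_right hx.2 (h0 x)

theorem IsWeight.integral_le_mul_inv (hψ : IsWeight μ ψ m M) {f : X → ℝ} (hf : Integrable f μ)
    (h0 : ∀ x, 0 ≤ f x) : ∫ x, f x ∂μ ≤ M * ∫ x, (ψ x)⁻¹ * f x ∂μ := by
  rw [← integral_const_mul]
  refine integral_mono_ae hf ((hψ.integrable_inv_mul hf).const_mul M) ?_
  filter_upwards [hψ.bounds] with x hx
  have hp : 0 < ψ x := hψ.pos.trans_le hx.1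
  have : 1 ≤ M * (ψ x)⁻¹ := by rw [← div_eq_mul_inv, one_le_div hp]; exact hx.2
  nlinarith [h0 x]

theorem MeasureTheory.MemLp.integrable_norm_sq_two {F : Type*} [NormedAddCommGroup F] {f : X → F}
    (hf : MemLp f 2 μ) : Integrable (fun x => ‖f x‖ ^ 2) μ :=
  (memLp_two_iff_integrable_sq_norm hf.1).1 hf

variable {F : Type*} [NormedAddCommGroup F] [InnerProductSpace ℝ F]

theorem memLp_smul_of_norm_sq_le {c : X → ℝ} {g : X → F} {B : ℝ} (hc : MemLp c 2 μ)
    (hg : AEStronglyMeasurable g μ) (hgB : ∀ᵐ x ∂μ, ‖g x‖ ^ 2 ≤ B) :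
    MemLp (fun x => c x • g x) 2 μ := by
  refine hc.of_le_mul (c := Real.sqrt B) (hc.1.smul hg) ?_
  filter_upwards [hgB] with x hx
  rw [norm_smul, mul_comm]
  exact mul_le_mul_of_nonneg_right (Real.le_sqrt_of_sq_le hx) (norm_nonneg _)

theorem MeasureTheory.MemLp.integrable_mul_two {f g : X → ℝ} (hf : MemLp f 2 μ) (hg : MemLp g 2 μ) :
    Integrable (fun x => f x * g x) μ :=
  MemLp.integrable_mul (p := 2) (q := 2) hf hg

theorem smul_inner_le_quarter {B : ℝ} (c : ℝ) (g q : F) (hg : ‖g‖ ^ 2 ≤ B) :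
    inner ℝ (c • g) q ≤ ‖q‖ ^ 2 / 4 + B * c ^ 2 := by
  have h1 : inner ℝ (c • g) q ≤ |c| * ‖g‖ * ‖q‖ := by
    refine (real_inner_le_norm _ _).trans_eq ?_
    rw [norm_smul, Real.norm_eq_abs]
  have h2 : |c| * ‖g‖ * ‖q‖ ≤ ‖q‖ ^ 2 / 4 + (|c| * ‖g‖) ^ 2 := by
    nlinarith [sq_nonneg (‖q‖ / 2 - |c| * ‖g‖)]
  have h3 : (|c| * ‖g‖) ^ 2 ≤ B * c ^ 2 := by
    rw [mul_pow, sq_abs, mul_comm]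
    exact mul_le_mul_of_nonneg_right hg (sq_nonneg c)
  linarith

/-- Adding `h1` and τ times `h2` cancels the integral of d c. Then (c - c')c is half of c² - c'² +
(c - c')², the drift takes a quarter of the flux energy, and Young's inequality handles ρ and p. -/
theorem energy_step (hψ : IsWeight μ ψ m M) {R τ B : ℝ} (hR : 0 < R) (hτ : 0 < τ)
    {c c' d ρ p : X → ℝ} {q g : X → F} (hc : MemLp c 2 μ) (hc' : MemLp c' 2 μ)
    (hρ : MemLp ρ 2 μ) (hp : MemLp p 2 μ) (hq : MemLp q 2 μ)
    (hg : AEStronglyMeasurable g μ) (hgB : ∀ᵐ x ∂μ, ‖g x‖ ^ 2 ≤ B)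
    (h1 : (∫ x, R * ψ x * (c x - c' x) * c x ∂μ) + τ * (∫ x, d x * c x ∂μ)
      + τ * (∫ x, ρ x * c x ∂μ) - τ * (∫ x, p x * c x ∂μ) = 0)
    (h2 : (∫ x, (ψ x)⁻¹ * ‖q x‖ ^ 2 ∂μ) - (∫ x, d x * c x ∂μ)
      - (∫ x, (ψ x)⁻¹ * inner ℝ (c x • g x) (q x) ∂μ) = 0) :
    R / 2 * (∫ x, ψ x * c x ^ 2 ∂μ) + τ / 2 * (∫ x, (ψ x)⁻¹ * ‖q x‖ ^ 2 ∂μ) ≤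
      R / 2 * (∫ x, ψ x * c' x ^ 2 ∂μ) + τ * ((B / m + 1) * (∫ x, c x ^ 2 ∂μ)
        + 1 / 2 * (∫ x, ρ x ^ 2 ∂μ) + 1 / 2 * (∫ x, p x ^ 2 ∂μ)) := by
  have hcg := memLp_smul_of_norm_sq_le hc hg hgB
  have key := sum_mul_integral_nonneg (μ := μ)
    ![1, τ, -τ, τ / 2, -τ, -(R / 2), R / 2, τ * (B / m + 1), τ / 2, τ / 2]
    ![fun x => R * ψ x * (c x - c' x) * c x, fun x => ρ x * c x, fun x => p x * c x,
      fun x => (ψ x)⁻¹ * ‖q x‖ ^ 2, fun x => (ψ x)⁻¹ * inner ℝ (c x • g x) (q x),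
      fun x => ψ x * c x ^ 2, fun x => ψ x * c' x ^ 2, fun x => c x ^ 2, fun x => ρ x ^ 2,
      fun x => p x ^ 2] ?_ ?_
  · simp only [Fin.sum_univ_succ, Fin.sum_univ_zero, Matrix.cons_val_zero,
      Matrix.cons_val_succ] at key
    linear_combination key + h1 + τ * h2
  · have hcc : Integrable (fun x => R * ψ x * (c x - c' x) * c x) μ := by
      refine ((hψ.integrable_mul ((hc.sub hc').integrable_mul_two hc)).const_mul R).congr ?_
      filter_upwards with x
      simp only [Pi.sub_apply]
      ring
    simp only [Fin.forall_fin_succ, Matrix.cons_val_zero, Matrix.cons_val_succ]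
    exact ⟨hcc, hρ.integrable_mul_two hc, hp.integrable_mul_two hc,
      hψ.integrable_inv_mul hq.integrable_norm_sq_two,
      hψ.integrable_inv_mul (hcg.integrable_real_inner hq),
      hψ.integrable_mul hc.integrable_sq, hψ.integrable_mul hc'.integrable_sq, hc.integrable_sq,
      hρ.integrable_sq, hp.integrable_sq, fun i => i.elim0⟩
  · filter_upwards [hψ.bounds, hgB] with x hx hgx
    simp only [Fin.sum_univ_succ, Fin.sum_univ_zero, Matrix.cons_val_zero, Matrix.cons_val_succ]
    have hpos : 0 < ψ x := hψ.pos.trans_le hx.1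
    have hB : 0 ≤ B := (sq_nonneg _).trans hgx
    have e1 : (ψ x)⁻¹ * inner ℝ (c x • g x) (q x) ≤
        (ψ x)⁻¹ * ‖q x‖ ^ 2 / 4 + B / m * c x ^ 2 := by
      have h := mul_le_mul_of_nonneg_left (smul_inner_le_quarter (c x) (g x) (q x) hgx)
        (inv_nonneg.2 hpos.le)
      have h' : (ψ x)⁻¹ * (B * c x ^ 2) ≤ m⁻¹ * (B * c x ^ 2) :=
        mul_le_mul_of_nonneg_right (inv_anti₀ hψ.pos hx.1) (by positivity)
      calc _ ≤ _ := h
        _ = (ψ x)⁻¹ * ‖q x‖ ^ 2 / 4 + (ψ x)⁻¹ * (B * c x ^ 2) := by ring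
        _ ≤ (ψ x)⁻¹ * ‖q x‖ ^ 2 / 4 + m⁻¹ * (B * c x ^ 2) := by linarith
        _ = _ := by ring
    have e2 : 0 ≤ (ψ x)⁻¹ * ‖q x‖ ^ 2 := by positivity
    have e3 : 0 ≤ R * ψ x * (c x - c' x) ^ 2 := by positivity
    have e4 : 0 ≤ τ * ((ψ x)⁻¹ * ‖q x‖ ^ 2 / 2 - (ψ x)⁻¹ * inner ℝ (c x • g x) (q x)
        + B / m * c x ^ 2) := mul_nonneg hτ.le (by linarith)
    have e5 : 0 ≤ τ * ((ρ x + c x) ^ 2 + (p x - c x) ^ 2) := by positivity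
    nlinarith

/-- In `h1`/τ + `h2` - `h3` all divergence terms cancel, leaving ψ⁻¹ q·(q - q') and a drift term in
c - c' only. -/
theorem increment_step (hψ : IsWeight μ ψ m M) {R τ B : ℝ} (hR : 0 < R) (hτ : 0 < τ)
    {c c' d ρ p : X → ℝ} {q q' g : X → F} (hc : MemLp c 2 μ) (hc' : MemLp c' 2 μ)
    (hd : MemLp d 2 μ) (hρ : MemLp ρ 2 μ) (hp : MemLp p 2 μ) (hq : MemLp q 2 μ)
    (hq' : MemLp q' 2 μ)
    (hg : AEStronglyMeasurable g μ) (hgB : ∀ᵐ x ∂μ, ‖g x‖ ^ 2 ≤ B)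
    (h1 : (∫ x, R * ψ x * (c x - c' x) * (c x - c' x) ∂μ) + τ * (∫ x, d x * (c x - c' x) ∂μ)
      + τ * (∫ x, ρ x * (c x - c' x) ∂μ) - τ * (∫ x, p x * (c x - c' x) ∂μ) = 0)
    (h2 : (∫ x, (ψ x)⁻¹ * ‖q x‖ ^ 2 ∂μ) - (∫ x, d x * c x ∂μ)
      - (∫ x, (ψ x)⁻¹ * inner ℝ (c x • g x) (q x) ∂μ) = 0)
    (h3 : (∫ x, (ψ x)⁻¹ * inner ℝ (q' x) (q x) ∂μ) - (∫ x, d x * c' x ∂μ)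
      - (∫ x, (ψ x)⁻¹ * inner ℝ (c' x • g x) (q x) ∂μ) = 0) :
    R * m / 2 * (1 / τ * ∫ x, (c x - c' x) ^ 2 ∂μ)
        + 1 / 2 * (∫ x, (ψ x)⁻¹ * ‖q x‖ ^ 2 ∂μ)
        + 1 / 2 * (∫ x, (ψ x)⁻¹ * ‖q x - q' x‖ ^ 2 ∂μ) ≤
      1 / 2 * (∫ x, (ψ x)⁻¹ * ‖q' x‖ ^ 2 ∂μ)
        + B / (m * (R * m)) * (τ * ∫ x, (ψ x)⁻¹ * ‖q x‖ ^ 2 ∂μ)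
        + τ * (2 / (R * m) * ((∫ x, ρ x ^ 2 ∂μ) + ∫ x, p x ^ 2 ∂μ)) := by
  have hm := hψ.pos
  have hcg := memLp_smul_of_norm_sq_le hc hg hgB
  have hcg' := memLp_smul_of_norm_sq_le hc' hg hgB
  have hδ : MemLp (fun x => c x - c' x) 2 μ := hc.sub hc'
  have hδq : MemLp (fun x => q x - q' x) 2 μ := hq.sub hq'
  have hdd : ∫ x, d x * (c x - c' x) ∂μ = (∫ x, d x * c x ∂μ) - ∫ x, d x * c' x ∂μ := by
    simp_rw [mul_sub]
    exact integral_sub (hd.integrable_mul_two hc) (hd.integrable_mul_two hc')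
  have key := sum_mul_integral_nonneg (μ := μ)
    ![1 / τ, 1, -1, 1 / 2 + τ * (B / (m * (R * m))), -1, -1, 1, -(R * m / (2 * τ)), -(1 / 2), 1 / 2,
      τ * (2 / (R * m)), τ * (2 / (R * m))]
    ![fun x => R * ψ x * (c x - c' x) * (c x - c' x), fun x => ρ x * (c x - c' x),
      fun x => p x * (c x - c' x),
      fun x => (ψ x)⁻¹ * ‖q x‖ ^ 2, fun x => (ψ x)⁻¹ * inner ℝ (q' x) (q x),
      fun x => (ψ x)⁻¹ * inner ℝ (c x • g x) (q x),
      fun x => (ψ x)⁻¹ * inner ℝ (c' x • g x) (q x),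
      fun x => (c x - c' x) ^ 2, fun x => (ψ x)⁻¹ * ‖q x - q' x‖ ^ 2,
      fun x => (ψ x)⁻¹ * ‖q' x‖ ^ 2,
      fun x => ρ x ^ 2, fun x => p x ^ 2] ?_ ?_
  · simp only [Fin.sum_univ_succ, Fin.sum_univ_zero, Matrix.cons_val_zero,
      Matrix.cons_val_succ] at key
    rw [hdd] at h1
    have h1' : 1 / τ * (∫ x, R * ψ x * (c x - c' x) * (c x - c' x) ∂μ)
        + ((∫ x, d x * c x ∂μ) - ∫ x, d x * c' x ∂μ)
      + (∫ x, ρ x * (c x - c' x) ∂μ) - (∫ x, p x * (c x - c' x) ∂μ) = 0 := by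
      have hττ : 1 / τ * τ = 1 := one_div_mul_cancel hτ.ne'
      linear_combination (1 / τ) * h1 - ((∫ x, d x * c x ∂μ) - (∫ x, d x * c' x ∂μ)
        + (∫ x, ρ x * (c x - c' x) ∂μ) - ∫ x, p x * (c x - c' x) ∂μ) * hττ
    have e : R * m / 2 * (1 / τ * ∫ x, (c x - c' x) ^ 2 ∂μ) =
        R * m / (2 * τ) * ∫ x, (c x - c' x) ^ 2 ∂μ := by
      field_simp
    rw [e]
    linear_combination key + h1' + h2 - h3
  · have hcc : Integrable (fun x => R * ψ x * (c x - c' x) * (c x - c' x)) μ := by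
      refine ((hψ.integrable_mul hδ.integrable_sq).const_mul R).congr ?_
      filter_upwards with x
      ring
    simp only [Fin.forall_fin_succ, Matrix.cons_val_zero, Matrix.cons_val_succ]
    exact ⟨hcc, hρ.integrable_mul_two hδ, hp.integrable_mul_two hδ,
      hψ.integrable_inv_mul hq.integrable_norm_sq_two,
      hψ.integrable_inv_mul (hq'.integrable_real_inner hq),
      hψ.integrable_inv_mul (hcg.integrable_real_inner hq),
      hψ.integrable_inv_mul (hcg'.integrable_real_inner hq), hδ.integrable_sq,
      hψ.integrable_inv_mul hδq.integrable_norm_sq_two,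
      hψ.integrable_inv_mul hq'.integrable_norm_sq_two,
      hρ.integrable_sq, hp.integrable_sq, fun i => i.elim0⟩
  · filter_upwards [hψ.bounds, hgB] with x hx hgx
    simp only [Fin.sum_univ_succ, Fin.sum_univ_zero, Matrix.cons_val_zero, Matrix.cons_val_succ]
    have hpos : 0 < ψ x := hψ.pos.trans_le hx.1
    have hB : 0 ≤ B := (sq_nonneg _).trans hgx
    have hti : (ψ x)⁻¹ ≤ m⁻¹ := inv_anti₀ hψ.pos hx.1
    have hn : ‖q x - q' x‖ ^ 2 = ‖q x‖ ^ 2 - 2 * inner ℝ (q' x) (q x) + ‖q' x‖ ^ 2 := by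
      rw [norm_sub_sq_real, real_inner_comm]
    rw [hn]
    simp only [inner_smul_left, conj_trivial]
    have hy : inner ℝ (g x) (q x) ^ 2 ≤ B * ‖q x‖ ^ 2 := by
      have h := abs_real_inner_le_norm (g x) (q x)
      have h' := pow_le_pow_left₀ (abs_nonneg _) h 2
      rw [sq_abs, mul_pow] at h'
      exact h'.trans (mul_le_mul_of_nonneg_right hgx (sq_nonneg _))
    generalize hyd : (inner ℝ (g x) (q x) : ℝ) = y at hy
    generalize hδd : c x - c' x = δ
    have hcδ : c x = c' x + δ := by linarith
    rw [hcδ]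
    generalize htd : (ψ x)⁻¹ = t at hti
    have ht0 : 0 < t := by rw [← htd]; positivity
    set a := R * m with ha
    have ha0 : 0 < a := mul_pos hR hψ.pos
    -- Of the two factors ψ⁻¹ produced by squaring, one is bounded by 1/m and the other stays in the
    -- weighted flux energy.
    have e1 : t * (δ * y) ≤ a / (4 * τ) * δ ^ 2 + τ * (B / (m * a)) * (t * ‖q x‖ ^ 2) := by
      have s1 : t * (δ * y) ≤ a / (4 * τ) * δ ^ 2 + τ / a * (t * y) ^ 2 := by
        have : 0 ≤ (a * δ - 2 * τ * (t * y)) ^ 2 / (4 * τ * a) := by positivity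
        have e : (a * δ - 2 * τ * (t * y)) ^ 2 / (4 * τ * a) =
            a / (4 * τ) * δ ^ 2 + τ / a * (t * y) ^ 2 - t * (δ * y) := by
          field_simp
          ring
        linarith
      have s2 : (t * y) ^ 2 ≤ m⁻¹ * (t * (B * ‖q x‖ ^ 2)) := by
        calc (t * y) ^ 2 = t * (t * y ^ 2) := by ring
          _ ≤ m⁻¹ * (t * (B * ‖q x‖ ^ 2)) := by gcongr
      have s3 : τ / a * (t * y) ^ 2 ≤ τ / a * (m⁻¹ * (t * (B * ‖q x‖ ^ 2))) := by gcongr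
      have s4 : τ / a * (m⁻¹ * (t * (B * ‖q x‖ ^ 2))) =
          τ * (B / (m * a)) * (t * ‖q x‖ ^ 2) := by
        field_simp
      linarith
    have e2 : (p x - ρ x) * δ ≤ a / (4 * τ) * δ ^ 2 +
        τ * (2 / a) * (ρ x ^ 2 + p x ^ 2) := by
      have s1 : 0 ≤ (a * δ - 2 * τ * (p x - ρ x)) ^ 2 / (4 * τ * a) := by positivity
      have s2 : (a * δ - 2 * τ * (p x - ρ x)) ^ 2 / (4 * τ * a) =
          a / (4 * τ) * δ ^ 2 + τ / a * (p x - ρ x) ^ 2 - (p x - ρ x) * δ := by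
        field_simp
        ring
      have s3 : τ / a * (p x - ρ x) ^ 2 ≤ τ / a * (2 * (ρ x ^ 2 + p x ^ 2)) := by
        gcongr
        nlinarith [sq_nonneg (p x + ρ x)]
      have s4 : τ / a * (2 * (ρ x ^ 2 + p x ^ 2)) = τ * (2 / a) * (ρ x ^ 2 + p x ^ 2) := by ring
      linarith
    have e3 : a / τ * δ ^ 2 ≤ 1 / τ * (R * ψ x * δ * δ) := by
      have : a * δ ^ 2 ≤ R * ψ x * δ ^ 2 := by
        rw [ha]; gcongr; exact hx.1
      calc a / τ * δ ^ 2 = 1 / τ * (a * δ ^ 2) := by ring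
        _ ≤ 1 / τ * (R * ψ x * δ ^ 2) := by gcongr
        _ = _ := by ring
    -- Budget for the squared increment: a quarter absorbs the drift, a quarter the reaction and
    -- source, and half remains in the conclusion.
    have e4 : a / τ * δ ^ 2 = a / (4 * τ) * δ ^ 2 + a / (4 * τ) * δ ^ 2
        + a / (2 * τ) * δ ^ 2 := by
      field_simp
      ring
    linarith

/-- The test function is d itself; Young's inequality gives up a quarter of τd² to the time
difference and a quarter to the reaction and source. -/
theorem divergence_step (hψ : IsWeight μ ψ m M) {R τ : ℝ} (hR : 0 < R) (hτ : 0 < τ)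
    {c c' d ρ p : X → ℝ} (hc : MemLp c 2 μ) (hc' : MemLp c' 2 μ)
    (hd : MemLp d 2 μ) (hρ : MemLp ρ 2 μ) (hp : MemLp p 2 μ)
    (h1 : (∫ x, R * ψ x * (c x - c' x) * d x ∂μ) + τ * (∫ x, d x * d x ∂μ)
      + τ * (∫ x, ρ x * d x ∂μ) - τ * (∫ x, p x * d x ∂μ) = 0) :
    τ / 2 * (∫ x, d x ^ 2 ∂μ) ≤ (R * M) ^ 2 * (1 / τ * ∫ x, (c x - c' x) ^ 2 ∂μ)
      + τ * (2 * ((∫ x, ρ x ^ 2 ∂μ) + ∫ x, p x ^ 2 ∂μ)) := by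
  have hδ : MemLp (fun x => c x - c' x) 2 μ := hc.sub hc'
  have key := sum_mul_integral_nonneg (μ := μ)
    ![1, τ, -τ, τ / 2, (R * M) ^ 2 * (1 / τ), 2 * τ, 2 * τ]
    ![fun x => R * ψ x * (c x - c' x) * d x, fun x => ρ x * d x,
      fun x => p x * d x, fun x => d x ^ 2, fun x => (c x - c' x) ^ 2,
      fun x => ρ x ^ 2, fun x => p x ^ 2] ?_ ?_
  · simp only [Fin.sum_univ_succ, Fin.sum_univ_zero, Matrix.cons_val_zero,
      Matrix.cons_val_succ] at key
    simp_rw [← pow_two (d _)] at h1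
    linear_combination key + h1
  · have hcc : Integrable (fun x => R * ψ x * (c x - c' x) * d x) μ := by
      refine ((hψ.integrable_mul (hδ.integrable_mul_two hd)).const_mul R).congr ?_
      filter_upwards with x
      ring
    simp only [Fin.forall_fin_succ, Matrix.cons_val_zero, Matrix.cons_val_succ]
    exact ⟨hcc, hρ.integrable_mul_two hd, hp.integrable_mul_two hd, hd.integrable_sq,
      hδ.integrable_sq, hρ.integrable_sq, hp.integrable_sq, fun i => i.elim0⟩
  · filter_upwards [hψ.bounds] with x hx
    simp only [Fin.sum_univ_succ, Fin.sum_univ_zero, Matrix.cons_val_zero, Matrix.cons_val_succ]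
    have hpos : 0 < ψ x := hψ.pos.trans_le hx.1
    generalize c x - c' x = δ
    have e1 : 0 ≤ R * ψ x * δ * d x + τ / 4 * d x ^ 2 + (R * M) ^ 2 * (1 / τ) * δ ^ 2 := by
      have s1 : 0 ≤ (τ * d x + 2 * (R * ψ x * δ)) ^ 2 / (4 * τ) := by positivity
      have s2 : (τ * d x + 2 * (R * ψ x * δ)) ^ 2 / (4 * τ) =
          R * ψ x * δ * d x + τ / 4 * d x ^ 2 + (R * ψ x) ^ 2 * (1 / τ) * δ ^ 2 := by
        field_simp
        ring
      have s3 : (R * ψ x) ^ 2 * (1 / τ) * δ ^ 2 ≤ (R * M) ^ 2 * (1 / τ) * δ ^ 2 := by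
        gcongr
        exact hx.2
      linarith
    have e2 : 0 ≤ τ * ((ρ x - p x) * d x + 1 / 4 * d x ^ 2 + 2 * ρ x ^ 2 + 2 * p x ^ 2) :=
      mul_nonneg hτ.le (by nlinarith [sq_nonneg (d x + 2 * (ρ x - p x)), sq_nonneg (ρ x + p x)])
    linarith

/-- Adding `h1` and `h2` trades the divergence term for the pairing of A with G. A quarter of the
flux energy absorbs this pairing and another quarter the drift. -/
theorem initial_flux_bound (hψ : IsWeight μ ψ m M) {B L : ℝ} (hL : 0 < L)
    {c d : X → ℝ} {q g A G : X → F} (hc : MemLp c 2 μ)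
    (hq : MemLp q 2 μ) (hA : MemLp A 2 μ) (hG : MemLp G 2 μ)
    (hg : AEStronglyMeasurable g μ) (hgB : ∀ᵐ x ∂μ, ‖g x‖ ^ 2 ≤ B)
    (hAq : ∀ᵐ x ∂μ, ‖A x‖ ^ 2 ≤ L * ‖q x‖ ^ 2)
    (h1 : (∫ x, inner ℝ (A x) (G x) ∂μ) + ∫ x, d x * c x ∂μ = 0)
    (h2 : (∫ x, (ψ x)⁻¹ * ‖q x‖ ^ 2 ∂μ) - (∫ x, d x * c x ∂μ)
      - (∫ x, (ψ x)⁻¹ * inner ℝ (c x • g x) (q x) ∂μ) = 0) :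
    1 / 2 * (∫ x, (ψ x)⁻¹ * ‖q x‖ ^ 2 ∂μ) ≤
      M * L * (∫ x, ‖G x‖ ^ 2 ∂μ) + B / m * ∫ x, c x ^ 2 ∂μ := by
  have hcg := memLp_smul_of_norm_sq_le hc hg hgB
  have key := sum_mul_integral_nonneg (μ := μ)
    ![1, 1 / 2, -1, M * L, B / m]
    ![fun x => inner ℝ (A x) (G x), fun x => (ψ x)⁻¹ * ‖q x‖ ^ 2,
      fun x => (ψ x)⁻¹ * inner ℝ (c x • g x) (q x), fun x => ‖G x‖ ^ 2, fun x => c x ^ 2] ?_ ?_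
  · simp only [Fin.sum_univ_succ, Fin.sum_univ_zero, Matrix.cons_val_zero,
      Matrix.cons_val_succ] at key
    linear_combination key + h1 + h2
  · simp only [Fin.forall_fin_succ, Matrix.cons_val_zero, Matrix.cons_val_succ]
    exact ⟨hA.integrable_real_inner hG, hψ.integrable_inv_mul hq.integrable_norm_sq_two,
      hψ.integrable_inv_mul (hcg.integrable_real_inner hq), hG.integrable_norm_sq_two,
      hc.integrable_sq, fun i => i.elim0⟩
  · filter_upwards [hψ.bounds, hgB, hAq] with x hx hgx hAx
    simp only [Fin.sum_univ_succ, Fin.sum_univ_zero, Matrix.cons_val_zero, Matrix.cons_val_succ]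
    have hpos : 0 < ψ x := hψ.pos.trans_le hx.1
    have hB : 0 ≤ B := (sq_nonneg _).trans hgx
    have e1 : (ψ x)⁻¹ * inner ℝ (c x • g x) (q x) ≤
        1 / 4 * ((ψ x)⁻¹ * ‖q x‖ ^ 2) + B / m * c x ^ 2 := by
      have h := mul_le_mul_of_nonneg_left (smul_inner_le_quarter (c x) (g x) (q x) hgx)
        (inv_nonneg.2 hpos.le)
      have h' : (ψ x)⁻¹ * (B * c x ^ 2) ≤ m⁻¹ * (B * c x ^ 2) :=
        mul_le_mul_of_nonneg_right (inv_anti₀ hψ.pos hx.1) (by positivity)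
      calc _ ≤ _ := h
        _ = 1 / 4 * ((ψ x)⁻¹ * ‖q x‖ ^ 2) + (ψ x)⁻¹ * (B * c x ^ 2) := by ring
        _ ≤ 1 / 4 * ((ψ x)⁻¹ * ‖q x‖ ^ 2) + m⁻¹ * (B * c x ^ 2) := by linarith
        _ = _ := by ring
    have e2 : -inner ℝ (A x) (G x) ≤ 1 / 4 * ((ψ x)⁻¹ * ‖q x‖ ^ 2) + M * L * ‖G x‖ ^ 2 := by
      have s1 : -inner ℝ (A x) (G x) ≤ ‖A x‖ * ‖G x‖ :=
        (neg_le_abs _).trans (abs_real_inner_le_norm _ _)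
      have s2 : 0 ≤ (‖A x‖ - 2 * ψ x * L * ‖G x‖) ^ 2 / (4 * ψ x * L) := by positivity
      have s3 : (‖A x‖ - 2 * ψ x * L * ‖G x‖) ^ 2 / (4 * ψ x * L) =
          (ψ x)⁻¹ * ‖A x‖ ^ 2 / (4 * L) + ψ x * L * ‖G x‖ ^ 2 - ‖A x‖ * ‖G x‖ := by
        field_simp
        ring
      have s4 : (ψ x)⁻¹ * ‖A x‖ ^ 2 / (4 * L) ≤ (ψ x)⁻¹ * (L * ‖q x‖ ^ 2) / (4 * L) := by
        gcongr
      have s5 : (ψ x)⁻¹ * (L * ‖q x‖ ^ 2) / (4 * L) = 1 / 4 * ((ψ x)⁻¹ * ‖q x‖ ^ 2) := by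
        field_simp
      have s6 : ψ x * L * ‖G x‖ ^ 2 ≤ M * L * ‖G x‖ ^ 2 := by
        gcongr
        exact hx.2
      linarith
    linarith

end Weight

/-! ### The scheme in integrated form -/

theorem sub_mem_Wh {N : ℕ} {Ω : Set (Eu N)} {𝒯 : Mesh N Ω} {f g : Eu N → ℝ}
    (hf : f ∈ Wh 𝒯) (hg : g ∈ Wh 𝒯) : (fun x => f x - g x) ∈ Wh 𝒯 := by
  refine ⟨MemLp.sub hf.1 hg.1, fun s hs => ?_⟩
  obtain ⟨a, ha⟩ := hf.2 s hs
  obtain ⟨b, hb⟩ := hg.2 s hs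
  refine ⟨a - b, ?_⟩
  filter_upwards [ha, hb] with x h1 h2
  rw [h1, h2]

theorem ip_real {N : ℕ} (Ω : Set (Eu N)) (f g : Eu N → ℝ) :
    ip Ω f g = ∫ x in Ω, f x * g x := by
  simp [ip, mul_comm]

theorem mem_Uh_of_mem_Uhχ {N : ℕ} {Ω : Set (Eu N)} {χ : BC} {𝒯 : Mesh N Ω} {u : Eu N → Eu N}
    (hu : u ∈ Uhχ χ 𝒯) : u ∈ Uh 𝒯 := by
  cases χ with
  | dirichlet => exact hu
  | neumann => exact hu.1

/-- Integration by parts between `W` and the discrete flux space: the boundary terms vanish for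
either boundary condition. -/
theorem exists_grad_of_mem_Wχ {N : ℕ} {Ω : Set (Eu N)} {χ : BC} {f : Eu N → ℝ}
    (hf : f ∈ Wχ χ Ω) : ∃ G : Eu N → Eu N, HasWeakGrad Ω f G ∧
      ∀ (𝒯 : Mesh N Ω), ∀ u ∈ Uhχ χ 𝒯,
        (∫ x in Ω, inner ℝ (u x) (G x)) + ∫ x in Ω, divg Ω u x * f x = 0 := by
  cases χ with
  | dirichlet =>
    obtain ⟨G, hG, happ⟩ := hf
    exact ⟨G, hG, fun 𝒯 u hu => integral_inner_grad_of_InH10 hG happ (hasWeakDiv_divg hu.1)⟩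
  | neumann =>
    obtain ⟨G, hG⟩ := hf
    exact ⟨G, hG, fun 𝒯 u hu => hu.2.2 f G hG⟩

/-- The field `S(v_h)^{-1/2} v_h`. -/
def ProblemData.driftField {N : ℕ} (D : ProblemData N) (vh : Eu N → Eu N) : Eu N → Eu N :=
  fun x => drift D.Sm D.αL (vh x)

section Scheme

variable {N : ℕ} {Ω : Set (Eu N)} {D : ProblemData N} {𝒯 : Mesh N Ω} {τ : ℝ}
  {vh : Eu N → Eu N}

theorem ProblemData.Admissible.αL_pos (hD : D.Admissible Ω) : 0 < D.αL :=
  hD.αT_nonneg.trans_lt hD.αT_lt_αL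

theorem ProblemData.Admissible.isPosSqrt (hD : D.Admissible Ω) (vh : Eu N → Eu N) (x : Eu N) :
    IsPosSqrt (D.S vh x) (D.Shalf vh x) :=
  isPosSqrt_posSqrt_dispersion hD.Sm_pos hD.αT_nonneg hD.αT_lt_αL (vh x)

/-- If Ω is null, the bounds on ψ are vacuous and `ψmax` may be negative; the maximum with `ψmin`
keeps the upper constant positive. -/
theorem ProblemData.Admissible.isWeight (hD : D.Admissible Ω) :
    IsWeight (volume.restrict Ω) D.ψ D.ψmin (max D.ψmin D.ψmax) :=
  ⟨hD.ψmin_pos, hD.ψ_meas, hD.ψ_bounds.mono fun _ hx => ⟨hx.1, hx.2.trans (le_max_right _ _)⟩⟩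

theorem ProblemData.Admissible.inv_Shalf_apply (hD : D.Admissible Ω) (vh : Eu N → Eu N)
    (x : Eu N) :
    Matrix.toEuclideanLin (D.Shalf vh x)⁻¹ (vh x) = D.driftField vh x := by
  have hl : 0 < longitudinal D.Sm D.αL (vh x) := by
    have := hD.αL_pos
    have := hD.Sm_pos
    unfold longitudinal
    positivity
  exact (hD.isPosSqrt vh x).inv_apply_of_eigenvector hl (dispersion_apply_self _ _ _ _)

theorem ProblemData.Admissible.aestronglyMeasurable_driftField (hD : D.Admissible Ω)
    (hv : vh ∈ Uh 𝒯) : AEStronglyMeasurable (D.driftField vh) (volume.restrict Ω) := by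
  obtain ⟨d, hd⟩ := hv.1
  exact (continuous_drift hD.Sm_pos hD.αL_pos.le).comp_aestronglyMeasurable hd.1.1

theorem ProblemData.Admissible.norm_driftField_sq_le (hD : D.Admissible Ω) (hv : vh ∈ Uh 𝒯) :
    ∀ᵐ x ∂(volume.restrict Ω), ‖D.driftField vh x‖ ^ 2 ≤ linfnorm Ω vh / D.αL := by
  filter_upwards [linfnorm_bound_of_mem_Uh hv] with x hx
  exact (norm_drift_sq_le hD.Sm_pos hD.αL_pos _).trans
    (div_le_div_of_nonneg_right hx hD.αL_pos.le)

theorem ProblemData.Admissible.norm_Shalf_sq_le (hD : D.Admissible Ω) (hv : vh ∈ Uh 𝒯)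
    (q : Eu N → Eu N) :
    ∀ᵐ x ∂(volume.restrict Ω), ‖matAct (D.Shalf vh) q x‖ ^ 2 ≤
      (D.Sm + D.αL * linfnorm Ω vh) * ‖q x‖ ^ 2 := by
  filter_upwards [linfnorm_bound_of_mem_Uh hv] with x hx
  have h := (hD.isPosSqrt vh x).norm_sq_apply (q x)
  refine h.le.trans ((inner_dispersion_le hD.αT_lt_αL.le _ _).trans ?_)
  refine mul_le_mul_of_nonneg_right ?_ (sq_nonneg _)
  have := mul_le_mul_of_nonneg_left hx hD.αL_pos.le
  unfold longitudinal
  linarith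

/-- Symmetry of the root X = S^{1/2} gives X⁻¹a·Xb = a·b, and S⁻¹ = X⁻¹X⁻¹ turns the convective term
into the drift. The test flux q' is kept separate from q because the increment estimate tests the
equation at time n-1 with the flux of time n. -/
theorem FluxEq.integral_eq (hD : D.Admissible Ω) {c : Eu N → ℝ} {q q' : Eu N → Eu N}
    (h : FluxEq D 𝒯 vh c q) (hq' : matAct (D.Shalf vh) q' ∈ Uhχ D.χ 𝒯) :
    (∫ x in Ω, (D.ψ x)⁻¹ * inner ℝ (q x) (q' x))
      - (∫ x in Ω, divg Ω (matAct (D.Shalf vh) q') x * c x)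
      - (∫ x in Ω, (D.ψ x)⁻¹ * inner ℝ (c x • D.driftField vh x) (q' x)) = 0 := by
  have h0 := h _ hq'
  have e1 : ip Ω (matAct (fun x => (D.Shalf vh x)⁻¹) (fun x => (D.ψ x)⁻¹ • q x))
      (matAct (D.Shalf vh) q') = ∫ x in Ω, (D.ψ x)⁻¹ * inner ℝ (q x) (q' x) := by
    refine integral_congr_ae (Filter.Eventually.of_forall fun x => ?_)
    simp only [matAct]
    rw [(hD.isPosSqrt vh x).inner_inv_apply, real_inner_smul_left]
  have e2 : ip Ω (matAct (fun x => (D.S vh x)⁻¹) (fun x => ((D.ψ x)⁻¹ * c x) • vh x))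
      (matAct (D.Shalf vh) q') =
      ∫ x in Ω, (D.ψ x)⁻¹ * inner ℝ (c x • D.driftField vh x) (q' x) := by
    refine integral_congr_ae (Filter.Eventually.of_forall fun x => ?_)
    simp only [matAct]
    rw [(hD.isPosSqrt vh x).inner_inv_sq_apply, map_smul, hD.inv_Shalf_apply, mul_smul,
      real_inner_smul_left]
  rw [e1, e2, ip_real] at h0
  simp_rw [mul_comm (divg Ω _ _)]
  exact h0

theorem FluxEq.integral_self_eq (hD : D.Admissible Ω) {c : Eu N → ℝ} {q : Eu N → Eu N}
    (h : FluxEq D 𝒯 vh c q) (hq : matAct (D.Shalf vh) q ∈ Uhχ D.χ 𝒯) :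
    (∫ x in Ω, (D.ψ x)⁻¹ * ‖q x‖ ^ 2)
      - (∫ x in Ω, divg Ω (matAct (D.Shalf vh) q) x * c x)
      - (∫ x in Ω, (D.ψ x)⁻¹ * inner ℝ (c x • D.driftField vh x) (q x)) = 0 := by
  simpa only [real_inner_self_eq_norm_sq] using h.integral_eq hD hq

theorem ConcentrationEq.integral_eq {c' c : Eu N → ℝ} {q : Eu N → Eu N}
    (h : ConcentrationEq D 𝒯 τ vh c' c q) {w : Eu N → ℝ} (hw : w ∈ Wh 𝒯) :
    (∫ x in Ω, D.R * D.ψ x * (c x - c' x) * w x)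
      + τ * (∫ x in Ω, divg Ω (matAct (D.Shalf vh) q) x * w x)
      + τ * (∫ x in Ω, D.r (c' x) * w x) - τ * (∫ x in Ω, D.p x * w x) = 0 := by
  simpa only [ip_real] using h w hw

theorem integral_sq_projection_le {c c₀ : Eu N → ℝ} (hc : c ∈ Wh 𝒯) (hc₀ : InL2 Ω c₀)
    (h : ∀ w ∈ Wh 𝒯, ip Ω (fun x => c x - c₀ x) w = 0) :
    ∫ x in Ω, c x ^ 2 ≤ ∫ x in Ω, c₀ x ^ 2 := by
  have h0 := h c hc
  rw [ip_real] at h0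
  have hc2 : MemLp c 2 (volume.restrict Ω) := hc.1
  have hc02 : MemLp c₀ 2 (volume.restrict Ω) := hc₀
  -- Pointwise, 2(c - c₀)c - c² + c₀² = (c - c₀)², and the first term integrates to zero.
  have key := sum_mul_integral_nonneg (μ := volume.restrict Ω) ![2, -1, 1]
    ![fun x => (c x - c₀ x) * c x, fun x => c x ^ 2, fun x => c₀ x ^ 2] ?_ ?_
  · simp only [Fin.sum_univ_succ, Fin.sum_univ_zero, Matrix.cons_val_zero,
      Matrix.cons_val_succ] at key
    linarith
  · simp only [Fin.forall_fin_succ, Matrix.cons_val_zero, Matrix.cons_val_succ]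
    exact ⟨(hc2.sub hc02).integrable_mul_two hc2, hc2.integrable_sq, hc02.integrable_sq,
      fun i => i.elim0⟩
  · refine Filter.Eventually.of_forall fun x => ?_
    simp only [Fin.sum_univ_succ, Fin.sum_univ_zero, Matrix.cons_val_zero, Matrix.cons_val_succ]
    nlinarith [sq_nonneg (c x - c₀ x)]

/-- The bound P is chosen before the mesh. If r is bounded it comes from the finite measure of Ω,
and under linear growth from the L² bound k. -/
theorem exists_reaction_bound (hΩ : Bornology.IsBounded Ω) {r : ℝ → ℝ}
    (hr : (∃ B : ℝ, ∀ x : ℝ, |r x| ≤ B) ∨ (∃ rp : ℝ, ∀ x : ℝ, |r x| ≤ rp * |x|)) (k : ℝ) :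
    ∃ P : ℝ, 0 ≤ P ∧ ∀ (𝒯 : Mesh N Ω), ∀ w ∈ Wh 𝒯, ∫ x in Ω, w x ^ 2 ≤ k →
      ∫ x in Ω, r (w x) ^ 2 ≤ P := by
  have : IsFiniteMeasure (volume.restrict Ω) := ⟨by
    rw [Measure.restrict_apply_univ]; exact hΩ.measure_lt_top⟩
  rcases hr with ⟨B, hB⟩ | ⟨rp, hrp⟩
  · refine ⟨∫ _x in Ω, B ^ 2, integral_nonneg fun _ => sq_nonneg B, fun 𝒯 w hw _ => ?_⟩
    have h2 : MemLp (fun x => r (w x)) 2 (volume.restrict Ω) := (comp_mem_Wh hΩ r hw).1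
    exact integral_mono h2.integrable_sq (integrable_const _) fun x =>
      sq_le_sq.2 ((hB _).trans (le_abs_self B))
  · refine ⟨rp ^ 2 * |k|, by positivity, fun 𝒯 w hw hk => ?_⟩
    have h2 : MemLp (fun x => r (w x)) 2 (volume.restrict Ω) := (comp_mem_Wh hΩ r hw).1
    have hw2 : MemLp w 2 (volume.restrict Ω) := hw.1
    calc ∫ x in Ω, r (w x) ^ 2 ≤ ∫ x in Ω, rp ^ 2 * w x ^ 2 := by
          refine integral_mono h2.integrable_sq (hw2.integrable_sq.const_mul _) fun x => ?_
          have h := pow_le_pow_left₀ (abs_nonneg _) (hrp (w x)) 2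
          rwa [sq_abs, mul_pow, sq_abs] at h
      _ = rp ^ 2 * ∫ x in Ω, w x ^ 2 := integral_const_mul _ _
      _ ≤ rp ^ 2 * |k| := by
          gcongr
          exact hk.trans (le_abs_self k)

end Scheme

/-! ### Discrete time summation -/

theorem add_sum_le_of_step_le {M : ℕ} {x y : ℕ → ℝ} {τ z : ℝ}
    (h : ∀ n, 1 ≤ n → n ≤ M → x n + y n ≤ x (n - 1) + τ * z) :
    ∀ k ≤ M, x k + ∑ n ∈ Finset.Icc 1 k, y n ≤ x 0 + k * τ * z := by
  intro k
  induction k with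
  | zero => intro _; simp
  | succ k ih =>
    intro hk
    rw [Finset.sum_Icc_succ_top (by omega)]
    have h1 := ih (by omega)
    have h2 := h (k + 1) (by omega) hk
    rw [Nat.add_sub_cancel] at h2
    push_cast
    linarith

/-- The summed a priori estimates that follow from the energy inequality, the increment inequality
and the divergence inequality of each time step, and from the bound of the initial flux energy.
Here `F` and `E` are the energies of concentration and flux, `δ` and `Eδ` those of their
increments, and `d` that of the divergence. -/
theorem summed_estimates {M : ℕ} {τ T V a b e f₀ s y ℓ z : ℝ} {F E δ Eδ d : ℕ → ℝ}
    (hτ : 0 < τ) (hMT : M * τ ≤ T) (hV : 0 ≤ V) (ha : 0 < a) (hb : 0 ≤ b)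
    (he : 0 ≤ e) (hf₀ : 0 ≤ f₀) (hs : 0 ≤ s) (hy : 0 ≤ y) (hz : 0 ≤ z)
    (hF : ∀ n, 0 ≤ F n) (hE : ∀ n, 0 ≤ E n) (hδ : ∀ n, 0 ≤ δ n) (hEδ : ∀ n, 0 ≤ Eδ n)
    (hE0 : E 0 ≤ e * (1 + V)) (hF0 : F 0 ≤ f₀)
    (henergy : ∀ n, 1 ≤ n → n ≤ M → F n + τ * E n ≤ F (n - 1) + τ * (s * (1 + V)))
    (hincr : ∀ n, 1 ≤ n → n ≤ M →
      a * (1 / τ * δ n) + E n + Eδ n ≤ E (n - 1) + b * V * (τ * E n) + τ * y)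
    (hdiv : ∀ n, 1 ≤ n → n ≤ M → τ * d n ≤ ℓ * (1 / τ * δ n) + τ * z) :
    let κ := (e + b * (f₀ + T * s) + T * y) * (1 + V + V ^ 2)
    (a * (1 / τ * ∑ n ∈ Finset.Icc 1 M, δ n) ≤ κ) ∧ (∀ k ≤ M, E k ≤ κ) ∧
      (∑ n ∈ Finset.Icc 1 M, Eδ n ≤ κ) ∧
      τ * ∑ n ∈ Finset.Icc 1 M, d n ≤ ℓ * (1 / τ * ∑ n ∈ Finset.Icc 1 M, δ n) + T * z := by
  intro κ
  have hT : 0 ≤ T := le_trans (by positivity) hMT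
  have hkT : ∀ k ≤ M, (k : ℝ) * τ ≤ T := fun k hk =>
    le_trans (mul_le_mul_of_nonneg_right (Nat.cast_le.2 hk) hτ.le) hMT
  -- The summed energy estimate controls the drift contribution to the increments directly, so the
  -- final constant is not exponential in V.
  have hsumE : ∀ k ≤ M, ∑ n ∈ Finset.Icc 1 k, τ * E n ≤ (f₀ + T * s) * (1 + V) := by
    intro k hk
    have h := add_sum_le_of_step_le henergy k hk
    have h1 : (k : ℝ) * τ * (s * (1 + V)) ≤ T * (s * (1 + V)) :=
      mul_le_mul_of_nonneg_right (hkT k hk) (by positivity)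
    have h2 : f₀ ≤ f₀ * (1 + V) := le_mul_of_one_le_right hf₀ (by linarith)
    linarith [hF k]
  -- Proved for every k, not only M, because the supremum over time is also needed.
  have hmain : ∀ k ≤ M, E k + ∑ n ∈ Finset.Icc 1 k, (a * (1 / τ * δ n) + Eδ n) ≤ κ := by
    intro k hk
    have h := add_sum_le_of_step_le (x := E)
      (y := fun n => a * (1 / τ * δ n) + Eδ n - b * V * (τ * E n)) (τ := τ) (z := y) (M := M)
      (fun n h1 h2 => by linarith [hincr n h1 h2]) k hk
    rw [Finset.sum_sub_distrib, ← Finset.mul_sum] at h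
    have h1 : b * V * ∑ n ∈ Finset.Icc 1 k, τ * E n ≤ b * V * ((f₀ + T * s) * (1 + V)) :=
      mul_le_mul_of_nonneg_left (hsumE k hk) (by positivity)
    have h2 : (k : ℝ) * τ * y ≤ T * y := mul_le_mul_of_nonneg_right (hkT k hk) hy
    have h3 : e * (1 + V) ≤ e * (1 + V + V ^ 2) :=
      mul_le_mul_of_nonneg_left (by nlinarith) he
    have h4 : b * V * ((f₀ + T * s) * (1 + V)) ≤ b * (f₀ + T * s) * (1 + V + V ^ 2) := by
      have : 0 ≤ b * (f₀ + T * s) := by positivity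
      nlinarith
    have h5 : T * y ≤ T * y * (1 + V + V ^ 2) :=
      le_mul_of_one_le_right (by positivity) (by nlinarith)
    have hκ : κ = e * (1 + V + V ^ 2) + b * (f₀ + T * s) * (1 + V + V ^ 2)
        + T * y * (1 + V + V ^ 2) := by
      simp only [κ]; ring
    linarith
  have hδs : ∀ k, 0 ≤ ∑ n ∈ Finset.Icc 1 k, a * (1 / τ * δ n) := fun k =>
    Finset.sum_nonneg fun n _ => by have := hδ n; positivity
  have hEs : ∀ k, 0 ≤ ∑ n ∈ Finset.Icc 1 k, Eδ n := fun k => Finset.sum_nonneg fun n _ => hEδ n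
  simp_rw [Finset.sum_add_distrib] at hmain
  refine ⟨?_, fun k hk => ?_, ?_, ?_⟩
  · rw [Finset.mul_sum, Finset.mul_sum]
    linarith [hmain M le_rfl, hE M, hEs M]
  · linarith [hmain k hk, hδs k, hEs k]
  · linarith [hmain M le_rfl, hE M, hδs M]
  · have h := add_sum_le_of_step_le (x := fun _ => 0)
      (y := fun n => τ * d n - ℓ * (1 / τ * δ n)) (τ := τ) (z := z) (M := M)
      (fun n h1 h2 => by linarith [hdiv n h1 h2]) M le_rfl
    rw [Finset.sum_sub_distrib] at h
    rw [Finset.mul_sum, Finset.mul_sum, Finset.mul_sum]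
    have h2 : (M : ℝ) * τ * z ≤ T * z := mul_le_mul_of_nonneg_right hMT hz
    linarith

/-! ### Making the dependence of the constants on V explicit -/

theorem l2norm_sq_real {N : ℕ} {Ω : Set (Eu N)} {f : Eu N → ℝ} (hf : InL2 Ω f) :
    l2norm Ω f ^ 2 = ∫ x in Ω, f x ^ 2 := by
  simp_rw [l2norm_sq hf, Real.norm_eq_abs, sq_abs]

theorem initial_flux_bound_le {E I Mψ Sm αL V G2 m c2 : ℝ} (hSm : 0 < Sm) (hα : 0 < αL)
    (hm : 0 < m) (hMψ : 0 < Mψ) (hV : 0 ≤ V) (hG2 : 0 ≤ G2) (hI : I ≤ c2)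
    (h : 1 / 2 * E ≤ Mψ * (Sm + αL * V) * G2 + V / αL / m * I) (hc2 : 0 ≤ c2) :
    E ≤ 2 * (Mψ * (Sm + αL) * G2 + 1 / (αL * m) * c2) * (1 + V) := by
  have e1 : V / αL / m * I ≤ V / αL / m * c2 := by gcongr
  have e2 : V / αL / m * c2 = 1 / (αL * m) * c2 * V := by field_simp
  have e3 : 0 ≤ 1 / (αL * m) * c2 := by positivity
  have e4 : 0 ≤ Mψ * Sm * G2 * V := by positivity
  have e5 : 0 ≤ Mψ * αL * G2 := by positivity
  linarith

theorem energy_bound_le {Fn F' E τ αL V m I J P p2 k : ℝ} (hα : 0 < αL) (hm : 0 < m)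
    (hτ : 0 < τ) (hV : 0 ≤ V) (hk : 0 ≤ k) (hP : 0 ≤ P) (hp2 : 0 ≤ p2) (hI : I ≤ k) (hJ : J ≤ P)
    {R : ℝ}
    (h : R / 2 * Fn + τ / 2 * E ≤
      R / 2 * F' + τ * ((V / αL / m + 1) * I + 1 / 2 * J + 1 / 2 * p2)) :
    R * Fn + τ * E ≤ R * F' + τ * ((2 * ((1 / (αL * m) + 1) * k) + P + p2) * (1 + V)) := by
  have e1 : (V / αL / m + 1) * I ≤ (V / αL / m + 1) * k := by gcongr
  have e2 : V / αL / m * k = 1 / (αL * m) * k * V := by field_simp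
  have e3 : 0 ≤ 1 / (αL * m) * k := by positivity
  have e4 : 0 ≤ k * V := by positivity
  have e5 : 0 ≤ (P + p2) * V := by positivity
  have hX : 2 * ((V / αL / m + 1) * I + 1 / 2 * J + 1 / 2 * p2) ≤
      (2 * ((1 / (αL * m) + 1) * k) + P + p2) * (1 + V) := by linarith
  linarith [mul_le_mul_of_nonneg_left hX hτ.le]

theorem increment_bound_le {δ E E' Eδ τ αL V m a J P p2 : ℝ} (hα : 0 < αL) (hm : 0 < m)
    (ha : 0 < a) (hτ : 0 < τ) (hJ : J ≤ P)
    (h : a / 2 * (1 / τ * δ) + 1 / 2 * E + 1 / 2 * Eδ ≤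
      1 / 2 * E' + V / αL / (m * a) * (τ * E) + τ * (2 / a * (J + p2))) :
    a * (1 / τ * δ) + E + Eδ ≤
      E' + 2 / (αL * m * a) * V * (τ * E) + τ * (4 / a * (P + p2)) := by
  have e1 : 2 / (αL * m * a) * V = 2 * (V / αL / (m * a)) := by field_simp
  have e2 : τ * (2 / a * (J + p2)) ≤ τ * (2 / a * (P + p2)) := by gcongr
  have e3 : τ * (4 / a * (P + p2)) = 2 * (τ * (2 / a * (P + p2))) := by ring
  rw [e1, e3]
  linarith

end

/-! ### The theorem -/

theorem mainTheorem2 (N : ℕ) (hN : 1 ≤ N) (hN3 : N ≤ 3)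
    (Ω : Set (Eu N)) (hΩ : IsOpen Ω) (hΩb : Bornology.IsBounded Ω)
    (D : ProblemData N) (hD : D.Admissible Ω)
    (hr : (∃ B : ℝ, ∀ x : ℝ, |D.r x| ≤ B) ∨ (∃ rp : ℝ, ∀ x : ℝ, |D.r x| ≤ rp * |x|))
    (T : ℝ) (hT : 0 < T) (K : ℝ) :
    ∃ C : ℝ, ∀ (𝒯 : Mesh N Ω) (τ : ℝ), 0 < τ →
      ∀ vh ∈ Uh 𝒯, ∀ (c : ℕ → Eu N → ℝ) (vc : ℕ → Eu N → Eu N),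
        IsDiscreteSolution D 𝒯 τ ⌊T / τ⌋₊ vh c vc →
        (∀ n : ℕ, 1 ≤ n → n ≤ ⌊T / τ⌋₊ →
          l2norm Ω (c n) ^ 2 + τ * l2norm Ω (vc n) ^ 2 ≤ K) →
        ((1 / τ) * ∑ n ∈ Finset.Icc 1 ⌊T / τ⌋₊, l2norm Ω (fun x => c n x - c (n - 1) x) ^ 2
            + (Finset.range (⌊T / τ⌋₊ + 1)).sup' Finset.nonempty_range_add_one
                (fun k => l2norm Ω (vc k) ^ 2)
            + ∑ n ∈ Finset.Icc 1 ⌊T / τ⌋₊, l2norm Ω (fun x => vc n x - vc (n - 1) x) ^ 2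
          ≤ C * (1 + linfnorm Ω vh + linfnorm Ω vh ^ 2))
        ∧ τ * ∑ n ∈ Finset.Icc 1 ⌊T / τ⌋₊, l2norm Ω (divg Ω (matAct (D.Shalf vh) (vc n))) ^ 2
          ≤ C * (1 + linfnorm Ω vh + linfnorm Ω vh ^ 2) := by
  obtain ⟨G, hG, hGu⟩ := exists_grad_of_mem_Wχ hD.c₀_mem
  have hc₀ : InL2 Ω D.c₀ := hG.1
  have hψ := hD.isWeight
  have hα := hD.αL_pos
  have hSm := hD.Sm_pos
  have hR := hD.R_pos
  have hm := hD.ψmin_pos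
  set m := D.ψmin with hm_def
  set Mψ := max D.ψmin D.ψmax with hMψ
  have hMψ0 : 0 < Mψ := hm.trans_le (le_max_left _ _)
  set c2 := ∫ x in Ω, D.c₀ x ^ 2 with hc2
  have hc20 : 0 ≤ c2 := integral_nonneg fun x => sq_nonneg _
  set G2 := ∫ x in Ω, ‖G x‖ ^ 2 with hG2
  have hG20 : 0 ≤ G2 := integral_nonneg fun x => sq_nonneg _
  set p2 := ∫ x in Ω, D.p x ^ 2 with hp2
  have hp20 : 0 ≤ p2 := integral_nonneg fun x => sq_nonneg _
  -- Bounds the squared norm of c^n for every n: the hypothesis with K starts at n = 1, while the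
  -- first step involves r(c^0), controlled through the projection by c₀.
  set k := |K| + c2 with hk
  have hk0 : 0 ≤ k := by positivity
  obtain ⟨P, hP0, hP⟩ := exists_reaction_bound hΩb hr k
  set a := D.R * m with ha_def
  have ha : 0 < a := mul_pos hR hm
  set e := 2 * (Mψ * (D.Sm + D.αL) * G2 + 1 / (D.αL * m) * c2) with he_def
  set s := 2 * ((1 / (D.αL * m) + 1) * k) + P + p2 with hs_def
  set b := 2 / (D.αL * m * a) with hb_def
  set y := 4 / a * (P + p2) with hy_def
  set z := 4 * (P + p2) with hz_def
  set ℓ := 2 * (D.R * Mψ) ^ 2 with hℓ_def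
  set κ₀ := e + b * (D.R * Mψ * c2 + T * s) + T * y with hκ₀
  have hb0 : 0 ≤ b := by positivity
  have he0 : 0 ≤ e := by positivity
  have hs0 : 0 ≤ s := by positivity
  have hy0 : 0 ≤ y := by positivity
  have hz0 : 0 ≤ z := by positivity
  have hℓ0 : 0 ≤ ℓ := by positivity
  have hκ₀0 : 0 ≤ κ₀ := by positivity
  clear_value κ₀ ℓ z y b s e a k p2 G2 c2 Mψ m
  -- The term 1/a serves the time differences, and the two copies of Mψ remove the weight ψ⁻¹ from
  -- the supremum and from the flux increments. The second summand is the divergence bound.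
  refine ⟨((1 / a + 2 * Mψ) * κ₀) + (ℓ * (κ₀ / a) + T * z), ?_⟩
  intro 𝒯 τ hτ vh hvh c vc hsol hK
  set M := ⌊T / τ⌋₊ with hM
  set V := linfnorm Ω vh with hV_def
  have hV : 0 ≤ V := ENNReal.toReal_nonneg
  have hMT : M * τ ≤ T := (le_div_iff₀ hτ).1 (Nat.floor_le (by positivity))
  clear_value M
  have hg := hD.aestronglyMeasurable_driftField hvh
  have hgB := hD.norm_driftField_sq_le hvh
  have hAV := hD.norm_Shalf_sq_le hvh
  rw [← hV_def] at hgB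
  simp only [← hV_def] at hAV
  clear_value V
  have hc : ∀ n ≤ M, MemLp (c n) 2 (volume.restrict Ω) := fun n hn => (hsol.c_mem n hn).1
  have hq : ∀ n ≤ M, MemLp (vc n) 2 (volume.restrict Ω) := hsol.vc_mem
  have hdW : ∀ n ≤ M, divg Ω (matAct (D.Shalf vh) (vc n)) ∈ Wh 𝒯 := fun n hn =>
    divg_mem_Wh hΩ (mem_Uh_of_mem_Uhχ (hsol.flux_mem n hn))
  have hd : ∀ n ≤ M, MemLp (divg Ω (matAct (D.Shalf vh) (vc n))) 2 (volume.restrict Ω) :=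
    fun n hn => (hdW n hn).1
  have hρ : ∀ n ≤ M, MemLp (fun x => D.r (c n x)) 2 (volume.restrict Ω) :=
    fun n hn => (comp_mem_Wh hΩb D.r (hsol.c_mem n hn)).1
  have hp : MemLp D.p 2 (volume.restrict Ω) := hD.p_mem
  have hc0k : ∫ x in Ω, c 0 x ^ 2 ≤ c2 :=
    (integral_sq_projection_le (hsol.c_mem 0 (Nat.zero_le _)) hc₀ hsol.initial).trans_eq hc2.symm
  have hck : ∀ n ≤ M, ∫ x in Ω, c n x ^ 2 ≤ k := by
    intro n hn
    rcases Nat.eq_zero_or_pos n with rfl | hn1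
    · exact hc0k.trans (hk ▸ le_add_of_nonneg_left (abs_nonneg K))
    · have h := hK n hn1 hn
      rw [l2norm_sq_real (hsol.c_mem n hn).1] at h
      have h2 : 0 ≤ τ * l2norm Ω (vc n) ^ 2 := by positivity
      rw [hk]
      linarith only [h, h2, hc20, le_abs_self K]
  have hρP : ∀ n ≤ M, ∫ x in Ω, D.r (c n x) ^ 2 ≤ P := fun n hn =>
    hP 𝒯 (c n) (hsol.c_mem n hn) (hck n hn)
  have hψi : 0 ≤ᵐ[volume.restrict Ω] fun x => (D.ψ x)⁻¹ :=
    hψ.bounds.mono fun x hx => inv_nonneg.2 (hm.le.trans hx.1)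
  have hE : ∀ n, 0 ≤ ∫ x in Ω, (D.ψ x)⁻¹ * ‖vc n x‖ ^ 2 := fun n =>
    integral_nonneg_of_ae (hψi.mono fun x hx => mul_nonneg hx (sq_nonneg _))
  have hEδ : ∀ n, 0 ≤ ∫ x in Ω, (D.ψ x)⁻¹ * ‖vc n x - vc (n - 1) x‖ ^ 2 := fun n =>
    integral_nonneg_of_ae (hψi.mono fun x hx => mul_nonneg hx (sq_nonneg _))
  have hF : ∀ n, 0 ≤ D.R * ∫ x in Ω, D.ψ x * c n x ^ 2 := fun n =>
    mul_nonneg hR.le (integral_nonneg_of_ae (hψ.bounds.mono fun x hx =>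
      mul_nonneg (hm.le.trans hx.1) (sq_nonneg _)))
  have hδ : ∀ n, 0 ≤ ∫ x in Ω, (c n x - c (n - 1) x) ^ 2 := fun n =>
    integral_nonneg fun x => sq_nonneg _
  have hF0 : D.R * ∫ x in Ω, D.ψ x * c 0 x ^ 2 ≤ D.R * Mψ * c2 := by
    have h := hψ.integral_mul_le (hc 0 (Nat.zero_le _)).integrable_sq fun x => sq_nonneg _
    rw [mul_assoc]
    exact mul_le_mul_of_nonneg_left (h.trans (mul_le_mul_of_nonneg_left hc0k hMψ0.le)) hR.le
  have hE0 : ∫ x in Ω, (D.ψ x)⁻¹ * ‖vc 0 x‖ ^ 2 ≤ e * (1 + V) := by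
    have h0 : 0 ≤ M := Nat.zero_le _
    have hL : 0 < D.Sm + D.αL * V := by positivity
    -- The divergence of the initial flux is in W_h, so c^0 - c₀ is orthogonal to it.
    have hproj := hsol.initial _ (hdW 0 h0)
    rw [ip_real] at hproj
    have hibp := hGu 𝒯 _ (hsol.flux_mem 0 h0)
    have hdc : ∫ x in Ω, divg Ω (matAct (D.Shalf vh) (vc 0)) x * D.c₀ x =
        ∫ x in Ω, divg Ω (matAct (D.Shalf vh) (vc 0)) x * c 0 x := by
      have h1 : ∫ x in Ω, (c 0 x - D.c₀ x) * divg Ω (matAct (D.Shalf vh) (vc 0)) x =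
          (∫ x in Ω, divg Ω (matAct (D.Shalf vh) (vc 0)) x * c 0 x)
            - ∫ x in Ω, divg Ω (matAct (D.Shalf vh) (vc 0)) x * D.c₀ x := by
        rw [← integral_sub ((hd 0 h0).integrable_mul_two (hc 0 h0))
          ((hd 0 h0).integrable_mul_two hc₀)]
        congr 1
        ext x
        ring
      rw [h1] at hproj
      exact (sub_eq_zero.1 hproj).symm
    rw [hdc] at hibp
    have hA2 : MemLp (matAct (D.Shalf vh) (vc 0)) 2 (volume.restrict Ω) :=
      (hasWeakDiv_divg (mem_Uh_of_mem_Uhχ (hsol.flux_mem 0 h0)).1).1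
    have h := initial_flux_bound hψ hL (hc 0 h0) (hq 0 h0) hA2 hG.2.1 hg hgB
      (hAV _) hibp ((hsol.flux 0 h0).integral_self_eq hD (hsol.flux_mem 0 h0))
    rw [← hG2] at h
    exact (initial_flux_bound_le hSm hα hm hMψ0 hV hG20 hc0k h hc20).trans_eq (by rw [he_def])
  have henergy : ∀ n, 1 ≤ n → n ≤ M →
      (D.R * ∫ x in Ω, D.ψ x * c n x ^ 2) + τ * (∫ x in Ω, (D.ψ x)⁻¹ * ‖vc n x‖ ^ 2) ≤
        (D.R * ∫ x in Ω, D.ψ x * c (n - 1) x ^ 2) + τ * (s * (1 + V)) := by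
    intro n h1 hn
    have hn' : n - 1 ≤ M := (Nat.sub_le _ _).trans hn
    have h := energy_step hψ hR hτ (hc n hn) (hc (n - 1) hn') (hρ (n - 1) hn') hp (hq n hn)
      hg hgB ((hsol.concentration n h1 hn).integral_eq (hsol.c_mem n hn))
      ((hsol.flux n hn).integral_self_eq hD (hsol.flux_mem n hn))
    rw [← hp2] at h
    exact (energy_bound_le hα hm hτ hV hk0 hP0 hp20 (hck n hn) (hρP (n - 1) hn') h).trans_eq
      (by rw [hs_def])
  have hincr : ∀ n, 1 ≤ n → n ≤ M →
      a * (1 / τ * ∫ x in Ω, (c n x - c (n - 1) x) ^ 2)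
        + (∫ x in Ω, (D.ψ x)⁻¹ * ‖vc n x‖ ^ 2)
        + (∫ x in Ω, (D.ψ x)⁻¹ * ‖vc n x - vc (n - 1) x‖ ^ 2) ≤
      (∫ x in Ω, (D.ψ x)⁻¹ * ‖vc (n - 1) x‖ ^ 2)
        + b * V * (τ * ∫ x in Ω, (D.ψ x)⁻¹ * ‖vc n x‖ ^ 2) + τ * y := by
    intro n h1 hn
    have hn' : n - 1 ≤ M := (Nat.sub_le _ _).trans hn
    have h := increment_step hψ hR hτ (hc n hn) (hc (n - 1) hn') (hd n hn) (hρ (n - 1) hn') hp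
      (hq n hn) (hq (n - 1) hn') hg hgB
      ((hsol.concentration n h1 hn).integral_eq
        (sub_mem_Wh (hsol.c_mem n hn) (hsol.c_mem (n - 1) hn')))
      ((hsol.flux n hn).integral_self_eq hD (hsol.flux_mem n hn))
      -- The equation of the previous time, tested with the flux of the current one. For n = 1 this
      -- uses the flux equation at time 0.
      ((hsol.flux (n - 1) hn').integral_eq hD (hsol.flux_mem n hn))
    rw [← hp2, ← ha_def] at h
    exact (increment_bound_le hα hm ha hτ (hρP (n - 1) hn') h).trans_eq (by rw [hb_def, hy_def])
  have hdiv : ∀ n, 1 ≤ n → n ≤ M →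
      τ * (∫ x in Ω, divg Ω (matAct (D.Shalf vh) (vc n)) x ^ 2) ≤
        ℓ * (1 / τ * ∫ x in Ω, (c n x - c (n - 1) x) ^ 2) + τ * z := by
    intro n h1 hn
    have hn' : n - 1 ≤ M := (Nat.sub_le _ _).trans hn
    have h := divergence_step hψ hR hτ (hc n hn) (hc (n - 1) hn') (hd n hn) (hρ (n - 1) hn') hp
      ((hsol.concentration n h1 hn).integral_eq (hdW n hn))
    rw [← hp2] at h
    have h' := mul_le_mul_of_nonneg_left (hρP (n - 1) hn') hτ.le
    rw [hℓ_def, hz_def]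
    linear_combination 2 * h + 4 * h'
  obtain ⟨r1, r2, r3, r4⟩ := summed_estimates (f₀ := D.R * Mψ * c2) hτ hMT hV ha
    hb0 he0 (by positivity) hs0 hy0 hz0 hF hE hδ hEδ hE0 hF0 henergy hincr hdiv
  rw [← hκ₀] at r1 r3
  simp only [← hκ₀] at r2
  set W := 1 + V + V ^ 2 with hW
  have hW1 : 1 ≤ W := by rw [hW, add_assoc]; exact le_add_of_nonneg_right (by positivity)
  have hsδ : ∑ n ∈ Finset.Icc 1 M, l2norm Ω (fun x => c n x - c (n - 1) x) ^ 2 =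
      ∑ n ∈ Finset.Icc 1 M, ∫ x in Ω, (c n x - c (n - 1) x) ^ 2 := by
    refine Finset.sum_congr rfl fun n hn => ?_
    have hn := (Finset.mem_Icc.1 hn).2
    exact l2norm_sq_real ((hc n hn).sub (hc (n - 1) ((Nat.sub_le _ _).trans hn)))
  have hsd : ∑ n ∈ Finset.Icc 1 M, l2norm Ω (divg Ω (matAct (D.Shalf vh) (vc n))) ^ 2 =
      ∑ n ∈ Finset.Icc 1 M, ∫ x in Ω, divg Ω (matAct (D.Shalf vh) (vc n)) x ^ 2 :=
    Finset.sum_congr rfl fun n hn => l2norm_sq_real (hd n (Finset.mem_Icc.1 hn).2)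
  have hsq : ∑ n ∈ Finset.Icc 1 M, l2norm Ω (fun x => vc n x - vc (n - 1) x) ^ 2 ≤
      Mψ * ∑ n ∈ Finset.Icc 1 M, ∫ x in Ω, (D.ψ x)⁻¹ * ‖vc n x - vc (n - 1) x‖ ^ 2 := by
    rw [Finset.mul_sum]
    refine Finset.sum_le_sum fun n hn => ?_
    have hn := (Finset.mem_Icc.1 hn).2
    have h : MemLp (fun x => vc n x - vc (n - 1) x) 2 (volume.restrict Ω) :=
      (hq n hn).sub (hq (n - 1) ((Nat.sub_le _ _).trans hn))
    rw [l2norm_sq h]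
    exact hψ.integral_le_mul_inv h.integrable_norm_sq_two fun x => sq_nonneg _
  have hsup : (Finset.range (M + 1)).sup' Finset.nonempty_range_add_one
      (fun k => l2norm Ω (vc k) ^ 2) ≤ Mψ * (κ₀ * W) := by
    refine Finset.sup'_le _ _ fun j hj => ?_
    have hj : j ≤ M := Nat.lt_succ_iff.1 (Finset.mem_range.1 hj)
    rw [l2norm_sq (hq j hj)]
    exact (hψ.integral_le_mul_inv (hq j hj).integrable_norm_sq_two fun x => sq_nonneg _).trans
      (mul_le_mul_of_nonneg_left (r2 j hj) hMψ0.le)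
  have r1' : 1 / τ * ∑ n ∈ Finset.Icc 1 M, ∫ x in Ω, (c n x - c (n - 1) x) ^ 2 ≤
      κ₀ * W / a := by
    rw [le_div_iff₀ ha, mul_comm]
    exact r1
  have hfirst : 0 ≤ (1 / a + 2 * Mψ) * κ₀ * W := by positivity
  have hsecond : 0 ≤ (ℓ * (κ₀ / a) + T * z) * W := by positivity
  rw [hsδ, hsd, add_mul]
  constructor
  · have h := mul_le_mul_of_nonneg_left r3 hMψ0.le
    refine le_trans ?_ (le_add_of_nonneg_right hsecond)
    linear_combination r1' + hsup + hsq + h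
  · refine le_trans ?_ (le_add_of_nonneg_left hfirst)
    have h1 := le_mul_of_one_le_right (by positivity : 0 ≤ T * z) hW1
    have h2 := mul_le_mul_of_nonneg_left r1' hℓ0
    linear_combination r4 + h1 + h2
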